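/- All graphs are finite, simple and nonempty. A graph $G$ is a *partial cube* if it is isomorphic to an isometric subgraph of a hypercube graph $Q_d$ for some $d$. For an edge $uv$ of $G$ let $W(u,v)=\{x : d_G(x,u)<d_G(x,v)\}$; the $\Theta$-class of $uv$ is the set of all edges with one end in $W(u,v)$ and the other in $W(v,u)$, and $W(u,v)$, $W(v,u)$ are its two halfspaces. A *pc-minor* of a partial cube $G$ is any graph that is, up to isomorphism, obtained from $G$ by a finite sequence of operations each of which either restricts the current graph to the subgraph induced by a halfspace of one of its $\Theta$-classes, or contracts all edges of one of its $\Theta$-classes. For a set $X$ of partial cubes let $\mathcal F(X)$ be the class of all partial cubes that have no member of $X$ as a pc-minor. **Proposition.** Let $X$ be a fixed finite set of partial cubes. Then it is decidable in polynomial time whether a given partial cube $G$ belongs to $\mathcal F(X)$. That is, there are a (deterministic, multi-stack) Turing machine $M$ and a polynomial $p$, both depending only on $X$, such that for every $n\ge 1$ and every partial cube $G$ on the vertex set $\{0,\dots,n-1\}$, the machine $M$, started on the adjacency matrix of $G$ written row by row with an end-of-row symbol after each row (a word of length $n(n+1)$), halts after at most $p(n(n+1))$ steps and outputs whether $G\in\mathcal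 F(X)$. -/

import Mathlib

namespace PartialCubes

/-- The hypercube graph `Q_d`: vertices are the sign vectors of length `d`, and two of them are
adjacent if they differ in exactly one coordinate. -/
def hypercube (d : ℕ) : SimpleGraph (Fin d → Bool) where
  Adj x y := ∃! i, x i ≠ y i
  symm := ⟨fun _ _ ⟨i, hi, hu⟩ => ⟨i, hi.symm, fun j hj => hu j hj.symm⟩⟩
  loopless := ⟨fun _ ⟨_, hi, _⟩ => hi rfl⟩

section Graph

variable {V : Type*}

/-- A (nonempty) graph is a partial cube if it is isomorphic to an isometric subgraph of some
hypercube `Q_d`. The extended distance is `⊤` between vertices in different components, so a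
partial cube is connected. -/
def IsPartialCube (G : SimpleGraph V) : Prop :=
  Nonempty V ∧ ∃ (d : ℕ) (f : G ↪g hypercube d),
    ∀ u v : V, G.edist u v = (hypercube d).edist (f u) (f v)

/-- The set `W(u,v)` of vertices closer to `u` than to `v`. For an edge `uv` of a partial cube,
`W(u,v)` and `W(v,u)` are the two complementary halfspaces of the `Θ`-class of `uv`. -/
def halfspace (G : SimpleGraph V) (u v : V) : Set V :=
  {x | G.edist x u < G.edist x v}

/-- The `Θ`-class of the edge `uv`: all edges with one end in `W(u,v)` and the other end in
`W(v,u)`. -/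
def thetaClass (G : SimpleGraph V) (u v : V) : Set (Sym2 V) :=
  {e | ∃ x y : V, e = s(x, y) ∧ G.Adj x y ∧ x ∈ halfspace G u v ∧ y ∈ halfspace G v u}

/-- The graph obtained from `G` by contracting the edges in `F`: its vertices are the connected
components of the graph with edge set `F`, and two different ones are adjacent if some edge of `G`
joins them. -/
def contractEdges (G : SimpleGraph V) (F : Set (Sym2 V)) :
    SimpleGraph (SimpleGraph.fromEdgeSet F).ConnectedComponent :=
  G.map (SimpleGraph.fromEdgeSet F).connectedComponentMk

end Graph

/-- `IsPCMinor G H`: the graph `H` is, up to isomorphism, obtained from `G` by a finite sequence of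
elementary restrictions (passing to the subgraph induced by one of the two halfspaces of a
`Θ`-class; the choice of the halfspace is the choice of the orientation `uv` of the edge) and
elementary contractions (contracting all edges of a `Θ`-class), in any order. -/
inductive IsPCMinor {V : Type} (G : SimpleGraph V) : {W : Type} → SimpleGraph W → Prop
  | self : IsPCMinor G G
  | iso {W W' : Type} {H : SimpleGraph W} {H' : SimpleGraph W'} :
      IsPCMinor G H → (H ≃g H') → IsPCMinor G H'
  | restriction {W : Type} {H : SimpleGraph W} {u v : W} :
      IsPCMinor G H → H.Adj u v → IsPCMinor G (H.induce (halfspace H u v))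
  | contraction {W : Type} {H : SimpleGraph W} {u v : W} :
      IsPCMinor G H → H.Adj u v → IsPCMinor G (contractEdges H (thetaClass H u v))

/-- A finite partial cube, with its vertices numbered `0, …, n - 1`. -/
structure PartialCube where
  /-- the number of vertices -/
  n : ℕ
  /-- the graph -/
  graph : SimpleGraph (Fin n)
  isPartialCube : IsPartialCube graph

/-- The class `𝓕(X)` of all partial cubes that have no member of `X` as a pc-minor. -/
def excluding (X : Set PartialCube) : Set PartialCube :=
  {G | ∀ H ∈ X, ¬ IsPCMinor G.graph H.graph}

open Classical in
/-- The encoding of a graph as a word: its adjacency matrix, row by row, where each entry is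
written as `some b` and each row is terminated by the symbol `none`. -/
noncomputable def PartialCube.encode (G : PartialCube) : List (Option Bool) :=
  (List.finRange G.n).flatMap fun i =>
    (List.finRange G.n).map (fun j => some (decide (G.graph.Adj i j))) ++ [none]

open Classical in
/-- A property `P` of objects that are given as words through `encode` is decidable in polynomial
time: some multi-stack Turing machine halts on the encoding of each object `a`, after a number of
steps that is bounded by a polynomial in the length of the encoding, and outputs the truth value
of `P a`. -/
def DecidableInPolyTime {α A : Type} (encode : α → List A) (P : α → Prop) : Prop :=
  Nonempty (Turing.TM2ComputableInPolyTime encode Computability.encodeBool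
    (fun a => decide (P a)))

end PartialCubes

/-! An isometric embedding in a cube turns vertices into sign vectors and Θ-classes into the
coordinates that are not constant. A restriction fixes the sign of one coordinate and a contraction
forgets one, so a pc-minor of `G` amounts to fixed signs on a set `I` of coordinates and a set `K`
of forgotten ones (`IsPCMinor.exists_rep`; conversely `IsCubeRep.exists_isPCMinor`).

Let `H` have `m` vertices and `k` coordinates, none of them constant. Then `H` is a pc-minor of `G`
if and only if `G` has a model of it (`HasModel`): a vertex for each vertex of `H` and an edge for
each coordinate of `H`, such that the chosen vertices lie on the prescribed sides of the edges, and
no vertex in their convex hull, the intersection of the halfspaces containing them, shows a new sign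
vector with respect to these edges. Given a model, one restricts to the hull and contracts all
classes other than those of the chosen edges (`HasModel.isPCMinor`). Given a minor, preimages of its
vertices and edges of the surviving classes form a model (`IsPCMinor.hasModel`).

A model is a choice of `m + 2k` vertices, a number that does not depend on `G`, and it is checked
with distances in `G` alone; the embedding occurs only in the proof. Exhaustive search is therefore
polynomial. For an actual machine, the condition is written as a `VecExpr` (`eval_modelExpr`), whose
quantifiers over vertices become loops of length `n`. Expressions compile to register programs on
Boolean vectors (`run_toVecProg`), these to structured stack programs (`ends_toRegProg`), and these
to a multi-stack machine (`Exec.iterate`), with a time bound composed along the syntax. -/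

/-! ### Structured stack programs and their compilation to multi-stack machines. -/

/-- Structured programs over stacks indexed by `K`, all with alphabet `A`, and a control state
in `σ`. -/
inductive StackProg (K A σ : Type) : Type
  | push (k : K) (f : σ → A)
  | pop (k : K) (f : σ → Option A → σ)
  | load (f : σ → σ)
  | seq (p q : StackProg K A σ)
  | ite (c : σ → Bool) (p q : StackProg K A σ)
  | while (c : σ → Bool) (p : StackProg K A σ)

namespace StackProg

open Turing Turing.TM2.Stmt

variable {K A σ : Type}

/-- The labels of the Turing machine fragment that implements a program. -/
def Label : StackProg K A σ → Type
  | push _ _ => Unit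
  | pop _ _ => Unit
  | load _ => Unit
  | seq p q => Label p ⊕ Label q
  | ite _ p q => Option (Label p ⊕ Label q)
  | .while _ p => Option (Label p)

noncomputable instance Label.fintype : ∀ p : StackProg K A σ, Fintype (Label p)
  | push _ _ => inferInstanceAs (Fintype Unit)
  | pop _ _ => inferInstanceAs (Fintype Unit)
  | load _ => inferInstanceAs (Fintype Unit)
  | seq p q =>
    letI := Label.fintype p
    letI := Label.fintype q
    inferInstanceAs (Fintype (Label p ⊕ Label q))
  | ite _ p q =>
    letI := Label.fintype p
    letI := Label.fintype q
    inferInstanceAs (Fintype (Option (Label p ⊕ Label q)))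
  | .while _ p =>
    letI := Label.fintype p
    inferInstanceAs (Fintype (Option (Label p)))

/-- The label at which the execution of a program starts. -/
def entry : ∀ p : StackProg K A σ, Label p
  | push _ _ => ()
  | pop _ _ => ()
  | load _ => ()
  | seq p _ => Sum.inl (entry p)
  | ite _ _ _ => (none : Option _)
  | .while _ _ => (none : Option _)

/-- The alphabets of a machine with one additional stack, the output stack `none`. -/
abbrev Alphabet (K A B : Type) : Option K → Type
  | none => B
  | some _ => A

/-- The stacks of the machine, while its output stack is empty. -/
def extend {B : Type} (S : K → List A) : ∀ k : Option K, List (Alphabet K A B k)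
  | none => []
  | some k => S k

theorem extend_update [DecidableEq K] {B : Type} (S : K → List A) (k : K) (l : List A) :
    Function.update (extend (B := B) S) (some k) l = extend (Function.update S k l) := by
  funext j
  rcases j with _ | j
  · rfl
  · by_cases h : j = k
    · subst h; simp [extend]
    · rw [Function.update_of_ne (by simpa using h)]
      simp [extend, Function.update_of_ne h]

/-- The machine code of a program, in a machine whose labels contain those of the program through
`e`, and which continues at `out`. -/
def code {B Λ : Type} : ∀ (p : StackProg K A σ) (_ : Label p → Λ) (_ : Λ),
    Label p → TM2.Stmt (Alphabet K A B) Λ σ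
  | push k f, _, out, _ => TM2.Stmt.push (some k) f (goto fun _ => out)
  | pop k f, _, out, _ => TM2.Stmt.pop (some k) f (goto fun _ => out)
  | load f, _, out, _ => TM2.Stmt.load f (goto fun _ => out)
  | seq p q, e, out, l =>
    Sum.elim (code p (fun l => e (Sum.inl l)) (e (Sum.inr (entry q))))
      (code q (fun l => e (Sum.inr l)) out) l
  | ite c p q, e, out, l =>
    Option.elim (α := Label p ⊕ Label q) l
      (branch c (goto fun _ => e (some (Sum.inl (entry p) : Label p ⊕ Label q)))
        (goto fun _ => e (some (Sum.inr (entry q) : Label p ⊕ Label q))))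
      (Sum.elim (code p (fun l => e (some (Sum.inl l : Label p ⊕ Label q))) out)
        (code q (fun l => e (some (Sum.inr l : Label p ⊕ Label q))) out))
  | .while c p, e, out, l =>
    Option.elim (α := Label p) l
      (branch c (goto fun _ => e (some (entry p) : Option (Label p))) (goto fun _ => out))
      (code p (fun l => e (some l : Option (Label p))) (e (none : Option (Label p))))

variable [DecidableEq K]

/-- `Exec p v S v' S' t`: started in the control state `v` with stacks `S`, the program `p` ends
after `t` steps, in the control state `v'` with stacks `S'`. -/
inductive Exec : StackProg K A σ → σ → (K → List A) → σ → (K → List A) → ℕ → Prop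
  | push {k f v S} : Exec (push k f) v S v (Function.update S k (f v :: S k)) 1
  | pop {k f v S} : Exec (pop k f) v S (f v (S k).head?) (Function.update S k (S k).tail) 1
  | load {f v S} : Exec (load f) v S (f v) S 1
  | seq {p q v S v₁ S₁ v₂ S₂ t₁ t₂} : Exec p v S v₁ S₁ t₁ → Exec q v₁ S₁ v₂ S₂ t₂ →
      Exec (seq p q) v S v₂ S₂ (t₁ + t₂)
  | ite_true {c p q v S v' S' t} : c v = true → Exec p v S v' S' t →
      Exec (ite c p q) v S v' S' (t + 1)
  | ite_false {c p q v S v' S' t} : c v = false → Exec q v S v' S' t →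
      Exec (ite c p q) v S v' S' (t + 1)
  | while_false {c p v S} : c v = false → Exec (.while c p) v S v S 1
  | while_true {c p v S v₁ S₁ v₂ S₂ t₁ t₂} : c v = true → Exec p v S v₁ S₁ t₁ →
      Exec (.while c p) v₁ S₁ v₂ S₂ t₂ → Exec (.while c p) v S v₂ S₂ (t₁ + t₂ + 1)

/-- Each rule of `Exec` is charged exactly the machine steps it causes, a test of a condition being
one step. The exit label `out` must be general in the induction: the first part of a sequence exits
to the entry of the second, and a loop body exits to the head of its loop. -/
theorem Exec.iterate {B Λ : Type} {M : Λ → TM2.Stmt (Alphabet K A B) Λ σ}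
    {p : StackProg K A σ} {v v' : σ} {S S' : K → List A} {t : ℕ} (h : Exec p v S v' S' t)
    (e : Label p → Λ) (out : Λ) (hM : ∀ l, M (e l) = code p e out l) :
    (flip bind (TM2.step M))^[t] (some ⟨some (e (entry p)), v, extend S⟩) =
      some ⟨some out, v', extend S'⟩ := by
  induction h generalizing out with
  | push | pop =>
    rw [Function.iterate_one]
    refine (congrArg (fun s => some (TM2.stepAux s _ _)) (hM (entry _))).trans ?_
    simp only [code, TM2.stepAux, ← extend_update (B := B)]
    rfl
  | load =>
    rw [Function.iterate_one]
    exact congrArg (fun s => some (TM2.stepAux s _ _)) (hM (entry _))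
  | seq h₁ h₂ ih₁ ih₂ =>
    rw [add_comm, Function.iterate_add_apply,
      show e (entry (StackProg.seq _ _)) = (fun l => e (Sum.inl l)) (entry _) from rfl,
      ih₁ (fun l => e (Sum.inl l)) (e (Sum.inr (entry _))) fun l => hM (Sum.inl l)]
    exact ih₂ (fun l => e (Sum.inr l)) out fun l => hM (Sum.inr l)
  | ite_true hc h ih =>
    rw [Function.iterate_succ_apply]
    rw [← ih (fun l => e (some (Sum.inl l) : Option (_ ⊕ _))) out
      fun l => hM (some (Sum.inl l) : Option (_ ⊕ _))]
    congr 1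
    refine (congrArg (fun s => some (TM2.stepAux s _ _)) (hM (entry _))).trans ?_
    simp [code, entry, hc]
  | ite_false hc h ih =>
    rw [Function.iterate_succ_apply]
    rw [← ih (fun l => e (some (Sum.inr l) : Option (_ ⊕ _))) out
      fun l => hM (some (Sum.inr l) : Option (_ ⊕ _))]
    congr 1
    refine (congrArg (fun s => some (TM2.stepAux s _ _)) (hM (entry _))).trans ?_
    simp [code, entry, hc]
  | while_false hc =>
    rw [Function.iterate_one]
    refine (congrArg (fun s => some (TM2.stepAux s _ _)) (hM (entry _))).trans ?_
    simp [code, entry, hc]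
  | while_true hc h₁ h₂ ih₁ ih₂ =>
    rw [Function.iterate_succ_apply, add_comm, Function.iterate_add_apply, ← ih₂ e out hM]
    congr 1
    refine Eq.trans ?_ (ih₁ (fun l => e (some l : Option _)) (e (none : Option _))
      fun l => hM (some l : Option _))
    congr 1
    refine (congrArg (fun s => some (TM2.stepAux s _ _)) (hM (entry _))).trans ?_
    simp [code, entry, hc]

/-! ### Hoare-style rules with time bounds. -/

/-- Started in `(v, S)`, the program `p` ends within `T` steps in some `(v', S')` that satisfies
`Q`. -/
def Ends (p : StackProg K A σ) (v : σ) (S : K → List A) (T : ℕ) (Q : σ → (K → List A) → Prop) :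
    Prop :=
  ∃ v' S' t, Exec p v S v' S' t ∧ t ≤ T ∧ Q v' S'

section Ends

variable {p q : StackProg K A σ} {v : σ} {S : K → List A} {T T₁ T₂ : ℕ}
  {P Q : σ → (K → List A) → Prop}

theorem Ends.imp (h : Ends p v S T P) (hQ : ∀ v S, P v S → Q v S) : Ends p v S T Q :=
  let ⟨v', S', t, h₁, h₂, h₃⟩ := h
  ⟨v', S', t, h₁, h₂, hQ _ _ h₃⟩

theorem Ends.le (h : Ends p v S T Q) (hT : T ≤ T₁) : Ends p v S T₁ Q :=
  let ⟨v', S', t, h₁, h₂, h₃⟩ := h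
  ⟨v', S', t, h₁, h₂.trans hT, h₃⟩

theorem Ends.push {k : K} {f : σ → A} (h : Q v (Function.update S k (f v :: S k))) :
    Ends (StackProg.push k f) v S 1 Q :=
  ⟨_, _, _, .push, le_rfl, h⟩

theorem Ends.pop {k : K} {f : σ → Option A → σ}
    (h : Q (f v (S k).head?) (Function.update S k (S k).tail)) :
    Ends (StackProg.pop k f) v S 1 Q :=
  ⟨_, _, _, .pop, le_rfl, h⟩

theorem Ends.load {f : σ → σ} (h : Q (f v) S) : Ends (StackProg.load f) v S 1 Q :=
  ⟨_, _, _, .load, le_rfl, h⟩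

theorem Ends.seq (h : Ends p v S T₁ fun v S => Ends q v S T₂ Q) :
    Ends (StackProg.seq p q) v S (T₁ + T₂) Q :=
  let ⟨_, _, _, h₁, h₂, _, _, _, h₄, h₅, h₆⟩ := h
  ⟨_, _, _, h₁.seq h₄, add_le_add h₂ h₅, h₆⟩

theorem Ends.ite {c : σ → Bool} (hp : c v = true → Ends p v S T₁ Q)
    (hq : c v = false → Ends q v S T₂ Q) : Ends (StackProg.ite c p q) v S (T₁ + T₂ + 1) Q := by
  cases hc : c v with
  | true =>
    obtain ⟨_, _, _, h₁, h₂, h₃⟩ := hp hc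
    exact ⟨_, _, _, .ite_true hc h₁, by omega, h₃⟩
  | false =>
    obtain ⟨_, _, _, h₁, h₂, h₃⟩ := hq hc
    exact ⟨_, _, _, .ite_false hc h₁, by omega, h₃⟩

theorem Ends.while_false {c : σ → Bool} (hc : c v = false) (h : Q v S) :
    Ends (StackProg.while c p) v S 1 Q :=
  ⟨_, _, _, .while_false hc, le_rfl, h⟩

theorem Ends.while_true {c : σ → Bool} (hc : c v = true)
    (h : Ends p v S T₁ fun v S => Ends (StackProg.while c p) v S T₂ Q) :
    Ends (StackProg.while c p) v S (T₁ + T₂ + 1) Q :=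
  let ⟨_, _, _, h₁, h₂, _, _, _, h₄, h₅, h₆⟩ := h
  ⟨_, _, _, .while_true hc h₁ h₄, by omega, h₆⟩

end Ends

end StackProg

/-! ### Loops that empty a stack. -/

namespace StackProg

/-- The symbols on the stacks: bits and the end-of-row symbol. -/
abbrev Sym := Option Bool

/-- The control states: two buffers for symbols read from stacks, and a flag. -/
abbrev Control := Option Sym × Option Sym × Bool

/-- The bit in a buffer. -/
def bit : Option Sym → Bool
  | some (some b) => b
  | _ => false

@[simp] theorem bit_some_some (b : Bool) : bit (some (some b)) = b := rfl

section Drain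

variable {K : Type}

/-- Read the symbol on top of a stack into the first buffer. -/
def read (k : K) : StackProg K Sym Control := pop k fun v o => (o, v.2)

/-- Empty the stack `k`, and run `body` after each symbol read. -/
def drain (k : K) (body : StackProg K Sym Control) : StackProg K Sym Control :=
  seq (read k) (.while (fun v => v.1.isSome) (seq body (read k)))

/-- Move all symbols from one stack to another one. -/
def move (k k' : K) : StackProg K Sym Control :=
  drain k (push k' fun v => v.1.getD none)

variable [DecidableEq K] {k k' : K} {v : Control} {S : K → List Sym} {T : ℕ}
  {Q : Control → (K → List Sym) → Prop}

/-- The loop invariant is indexed by a splitting of `l` into processed and remaining items: `C` is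
the flag and `St` the stacks. Each symbol is popped before `body` sees it, so in `hbody` the stack
`k` is already one symbol shorter while the symbol sits in the first buffer. Each item costs the
body, a test and a read; the extra 2 is the initial read and the final test. -/
theorem Ends.drain {α : Type*} {l : List α} {x : α → Sym} {body : StackProg K Sym Control}
    (C : List α → List α → Bool) (St : List α → List α → K → List Sym)
    (hk : ∀ l₁ l₂, l₁ ++ l₂ = l → St l₁ l₂ k = l₂.map x)
    (hbody : ∀ l₁ i l₂ y, l₁ ++ i :: l₂ = l →
      Ends body (some (x i), y, C l₁ (i :: l₂))
        (Function.update (St l₁ (i :: l₂)) k (l₂.map x)) T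
        fun v S => v.2.2 = C (l₁ ++ [i]) l₂ ∧ S = St (l₁ ++ [i]) l₂)
    (hv : v.2.2 = C [] l) (hS : S = St [] l)
    (hQ : ∀ x y, Q (x, y, C l []) (St l [])) :
    Ends (StackProg.drain k body) v S ((T + 2) * l.length + 2) Q := by
  have loop : ∀ l₂ l₁ : List α, l₁ ++ l₂ = l → ∀ y,
      Ends (.while (fun v => v.1.isSome) (StackProg.seq body (read k)))
        ((l₂.map x).head?, y, C l₁ l₂) (Function.update (St l₁ l₂) k (l₂.map x).tail)
        ((T + 2) * l₂.length + 1) Q := by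
    intro l₂
    induction l₂ with
    | nil =>
      intro l₁ h y
      obtain rfl : l₁ = l := by simpa using h
      refine Ends.while_false rfl ?_
      -- By `hk` the drained stack is already empty in the final invariant.
      have h' : Function.update (St l₁ []) k ([] : List Sym) = St l₁ [] :=
        (congrArg (Function.update (St l₁ []) k) (hk l₁ [] h).symm).trans
          (Function.update_eq_self _ _)
      simp only [List.map_nil, List.tail_nil, h']
      exact hQ _ _
    | cons i l₂ ih =>
      intro l₁ h y
      have h' : l₁ ++ [i] ++ l₂ = l := by simpa using h
      refine (Ends.while_true (c := fun v => v.1.isSome) (T₂ := (T + 2) * l₂.length + 1) rfl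
        (Ends.seq (T₂ := 1) ((hbody l₁ i l₂ y h).imp ?_))).le ?_
      · rintro ⟨_, b, _⟩ _ ⟨rfl, rfl⟩
        refine Ends.pop ?_
        rw [hk _ _ h']
        exact ih _ h' b
      · simp only [List.length_cons]
        ring_nf
        omega
  obtain ⟨a, b, c⟩ := v
  simp only at hv
  subst hv hS
  refine (Ends.seq (T₂ := (T + 2) * l.length + 1) (Ends.pop ?_)).le (by omega)
  rw [hk _ _ (List.nil_append l)]
  exact loop l [] rfl b

theorem Ends.move (hkk : k ≠ k')
    (hQ : ∀ x y, Q (x, y, v.2.2)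
      (Function.update (Function.update S k []) k' ((S k).reverse ++ S k'))) :
    Ends (StackProg.move k k') v S (3 * (S k).length + 2) Q := by
  refine (Ends.drain (l := S k) (x := id) (T := 1) (fun _ _ => v.2.2)
    (fun l₁ l₂ => Function.update (Function.update S k l₂) k' (l₁.reverse ++ S k'))
    ?_ ?_ rfl ?_ hQ).le (by omega)
  · intro l₁ l₂ _
    simp [hkk]
  · intro l₁ i l₂ y _
    refine Ends.push ⟨rfl, ?_⟩
    funext j
    by_cases h₁ : j = k' <;> by_cases h₂ : j = k <;> simp_all [Function.update_apply]
  · simp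

end Drain

/-! ### A register machine for Boolean vectors, with the matrix on the input stack. -/

section Registers

variable {ι : Type}

/-- The stacks of a register machine: the input, a stack that holds the part of the input that was
read, two auxiliary stacks, and the registers. -/
def memory (a b c d : List Sym) (ρ : ι → List Sym) : Fin 4 ⊕ ι → List Sym :=
  Sum.elim ![a, b, c, d] ρ

section

variable {a b c d l : List Sym} {ρ : ι → List Sym} {r : ι}

@[simp] theorem memory_zero : memory a b c d ρ (Sum.inl 0) = a := rfl
@[simp] theorem memory_one : memory a b c d ρ (Sum.inl 1) = b := rfl
@[simp] theorem memory_two : memory a b c d ρ (Sum.inl 2) = c := rfl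
@[simp] theorem memory_three : memory a b c d ρ (Sum.inl 3) = d := rfl
@[simp] theorem memory_inr : memory a b c d ρ (Sum.inr r) = ρ r := rfl

variable [DecidableEq ι]

theorem update_memory_inl (i : Fin 4) : Function.update (memory a b c d ρ) (Sum.inl i) l =
    Sum.elim (Function.update ![a, b, c, d] i l) ρ := by
  exact Sum.update_elim_inl

@[simp] theorem update_memory_zero :
    Function.update (memory a b c d ρ) (Sum.inl 0) l = memory l b c d ρ := by
  rw [update_memory_inl, memory]; congr 1; ext i; fin_cases i <;> rfl

@[simp] theorem update_memory_one :
    Function.update (memory a b c d ρ) (Sum.inl 1) l = memory a l c d ρ := by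
  rw [update_memory_inl, memory]; congr 1; ext i; fin_cases i <;> rfl

@[simp] theorem update_memory_two :
    Function.update (memory a b c d ρ) (Sum.inl 2) l = memory a b l d ρ := by
  rw [update_memory_inl, memory]; congr 1; ext i; fin_cases i <;> rfl

@[simp] theorem update_memory_three :
    Function.update (memory a b c d ρ) (Sum.inl 3) l = memory a b c l ρ := by
  rw [update_memory_inl, memory]; congr 1; ext i; fin_cases i <;> rfl

@[simp] theorem update_memory_inr :
    Function.update (memory a b c d ρ) (Sum.inr r) l = memory a b c d (Function.update ρ r l) :=
  Sum.update_elim_inr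

end

/-- Programs of a register machine. -/
abbrev RegProg (ι : Type) := StackProg (Fin 4 ⊕ ι) Sym Control

/-- Set the flag. -/
def setFlag (f : Control → Bool) : RegProg ι := load fun v => (v.1, v.2.1, f v)

/-- Replace the register `r` by the result of the pointwise operation `f` on `r` and `s`. -/
def zipReg (f : Bool → Bool → Bool) (r s : ι) : RegProg ι :=
  seq (drain (Sum.inr s) (seq (pop (Sum.inr r) fun v o => (v.1, o, v.2.2))
    (seq (push (Sum.inl 2) fun v => v.1.getD none)
      (push (Sum.inl 3) fun v => some (f (bit v.2.1) (bit v.1))))))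
    (seq (move (Sum.inl 2) (Sum.inr s)) (move (Sum.inl 3) (Sum.inr r)))

/-- Replace each bit of the register `r` by the disjunction of all of them. -/
def anyReg (r : ι) : RegProg ι :=
  seq (setFlag fun _ => false)
    (seq (drain (Sum.inr r) (seq (setFlag fun v => v.2.2 || bit v.1)
        (push (Sum.inl 2) fun v => v.1.getD none)))
      (drain (Sum.inl 2) (push (Sum.inr r) fun v => some v.2.2)))

/-- Replace each bit of the register `r` by `false`. -/
def zeroReg (r : ι) : RegProg ι :=
  seq (drain (Sum.inr r) (push (Sum.inl 2) fun _ => some false)) (move (Sum.inl 2) (Sum.inr r))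

/-- Shift the flag into the register `r`, and its last bit into the flag. -/
def shiftReg (r : ι) : RegProg ι :=
  seq (drain (Sum.inr r) (seq (push (Sum.inl 2) fun v => some v.2.2) (setFlag fun v => bit v.1)))
    (move (Sum.inl 2) (Sum.inr r))

/-- Replace the register `r` by the Boolean product of the input matrix and the register `s`. -/
def mulReg (r s : ι) : RegProg ι :=
  seq (setFlag fun _ => false)
    (seq (drain (Sum.inr r)
      (seq (drain (Sum.inr s) (seq (pop (Sum.inl 0) fun v o => (v.1, o, v.2.2))
        (seq (setFlag fun v => v.2.2 || (bit v.2.1 && bit v.1))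
          (seq (push (Sum.inl 2) fun v => v.1.getD none)
            (push (Sum.inl 1) fun v => v.2.1.getD none)))))
        (seq (push (Sum.inl 3) fun v => some v.2.2)
          (seq (pop (Sum.inl 0) fun v _ => v)
            (seq (push (Sum.inl 1) fun _ => none)
              (seq (move (Sum.inl 2) (Sum.inr s)) (setFlag fun _ => false)))))))
      (seq (move (Sum.inl 1) (Sum.inl 0)) (move (Sum.inl 3) (Sum.inr r))))

/-- Run `p` once for each index, where the register `r` holds the indicator vector of the index. -/
def forReg (r : ι) (p : RegProg ι) : RegProg ι :=
  seq (zeroReg r) (seq (setFlag fun _ => true) (seq (shiftReg r)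
    (.while (fun v => !v.2.2) (seq p (seq (setFlag fun _ => false) (shiftReg r))))))

/-- The contents of a stack that lists the values of `x` on `l`. -/
def bits {α : Type*} (l : List α) (x : α → Bool) : List Sym := l.map fun i => some (x i)

@[simp] theorem bits_nil {α : Type*} (x : α → Bool) : bits [] x = [] := rfl
@[simp] theorem bits_cons {α : Type*} (i : α) (l : List α) (x : α → Bool) :
    bits (i :: l) x = some (x i) :: bits l x := rfl
@[simp] theorem map_some_eq_bits {α : Type*} (l : List α) (x : α → Bool) :
    l.map (fun i => some (x i)) = bits l x := rfl
@[simp] theorem bits_map {α β : Type*} (l : List α) (f : α → β) (x : β → Bool) :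
    bits (l.map f) x = bits l fun i => x (f i) := List.map_map
@[simp] theorem length_bits {α : Type*} (l : List α) (x : α → Bool) :
    (bits l x).length = l.length := List.length_map _
theorem bits_const {α : Type*} (l : List α) (c : Bool) :
    bits l (fun _ => c) = List.replicate l.length (some c) := List.map_const' ..
@[simp] theorem bits_append {α : Type*} (l l' : List α) (x : α → Bool) :
    bits (l ++ l') x = bits l x ++ bits l' x := List.map_append
@[simp] theorem reverse_bits {α : Type*} (l : List α) (x : α → Bool) :
    (bits l x).reverse = bits l.reverse x := List.map_reverse.symm

/-- The contents of the input stack: the rows of the matrix `M`, each with an end-of-row symbol. -/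
def rows {α β : Type*} (l : List α) (l' : List β) (M : α → β → Bool) : List Sym :=
  l.flatMap fun i => bits l' (M i) ++ [none]

variable [DecidableEq ι] {v : Control} {a b c d : List Sym} {ρ : ι → List Sym} {r s : ι}
  {Q : Control → (Fin 4 ⊕ ι → List Sym) → Prop} {α : Type*} {l : List α} {x y : α → Bool}

/-- Both registers are consumed in parallel, which requires `r ≠ s`. The auxiliary stacks receive
the old `s` and the results in reverse, and moving them back undoes the reversal. -/
theorem ends_zipReg {f : Bool → Bool → Bool} (hrs : r ≠ s) (hr : ρ r = bits l x)
    (hs : ρ s = bits l y)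
    (hQ : ∀ v', Q v' (memory a [] [] [] (Function.update ρ r (bits l fun i => f (x i) (y i))))) :
    Ends (zipReg f r s) v (memory a [] [] [] ρ) (11 * l.length + 6) Q := by
  refine (Ends.seq (Ends.drain (l := l) (x := fun i => some (y i)) (T := 3) (fun _ _ => v.2.2)
      (fun l₁ l₂ => memory a [] (bits l₁.reverse y) (bits l₁.reverse fun i => f (x i) (y i))
        (Function.update (Function.update ρ s (bits l₂ y)) r (bits l₂ x)))
      ?_ ?_ rfl ?_ fun _ _ => Ends.seq (Ends.move (by simp) fun _ _ => Ends.move (by simp)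
        fun _ _ => ?_))).le ?_
  · intro l₁ l₂ _
    simp [hrs.symm]
  · intro l₁ i l₂ y' _
    refine Ends.seq (Ends.pop (Ends.seq (Ends.push (Ends.push ⟨rfl, ?_⟩))))
    simp only [update_memory_inr, map_some_eq_bits, bits_cons, memory_inr, update_memory_two,
      update_memory_three, memory_two, memory_three]
    congr 1
    · simp
    · simp [hrs]
    · funext j
      by_cases h₁ : j = r <;> by_cases h₂ : j = s <;> simp_all
  · simp [← hr, ← hs]
  · convert hQ _ using 1
    simp only [update_memory_inr, update_memory_two, update_memory_three, memory_inr, memory_two,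
      memory_three]
    congr 1
    funext j
    by_cases h₁ : j = r <;> by_cases h₂ : j = s <;> simp_all
  · simp
    omega

/-- The flag accumulates the disjunction in the first pass; the second pass only counts symbols.
Since the result is a constant vector, its order does not matter. -/
theorem ends_anyReg (hr : ρ r = bits l x)
    (hQ : ∀ v', Q v' (memory a [] [] [] (Function.update ρ r (bits l fun _ => l.any x)))) :
    Ends (anyReg r) v (memory a [] [] [] ρ) (7 * l.length + 5) Q := by
  refine (Ends.seq (Ends.load (Ends.seq (Ends.drain (l := l) (x := fun i => some (x i)) (T := 2)
    (fun l₁ _ => l₁.any x)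
    (fun l₁ l₂ => memory a [] (bits l₁.reverse x) [] (Function.update ρ r (bits l₂ x)))
    ?_ ?_ rfl ?_ fun _ _ => Ends.drain (l := l.reverse) (x := fun i => some (x i)) (T := 1)
    (fun _ _ => l.any x)
    (fun l₁ l₂ => memory a [] (bits l₂ x) [] (Function.update ρ r (bits l₁ fun _ => l.any x)))
    ?_ ?_ rfl ?_ fun _ _ => ?_)))).le ?_
  · simp
  · intro l₁ i l₂ y' _
    exact Ends.seq (Ends.load (Ends.push (by simp)))
  · simp [← hr]
  · simp
  · intro l₁ i l₂ y' _
    refine Ends.push ⟨rfl, ?_⟩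
    simp [bits_const, ← List.replicate_succ]
  · simp
  · convert hQ _ using 1
    simp [bits_const]
  · simp
    omega

theorem ends_zeroReg (hr : ρ r = bits l x)
    (hQ : ∀ v', Q v' (memory a [] [] [] (Function.update ρ r (bits l fun _ => false)))) :
    Ends (zeroReg r) v (memory a [] [] [] ρ) (6 * l.length + 4) Q := by
  refine (Ends.seq (Ends.drain (l := l) (x := fun i => some (x i)) (T := 1)
    (fun _ _ => v.2.2)
    (fun l₁ l₂ => memory a [] (bits l₁.reverse fun _ => false) []
      (Function.update ρ r (bits l₂ x)))
    ?_ ?_ rfl ?_ fun _ _ => Ends.move (by simp) fun _ _ => ?_)).le ?_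
  · simp
  · intro l₁ i l₂ y' _
    exact Ends.push (by simp)
  · simp [← hr]
  · convert hQ _ using 1
    simp
  · simp
    omega

theorem ends_shiftReg {l : List Bool} (hr : ρ r = bits l id)
    (hQ : ∀ x y, Q (x, y, (v.2.2 :: l).getLast (by simp)) (memory a [] [] []
      (Function.update ρ r (bits (v.2.2 :: l).dropLast id)))) :
    Ends (shiftReg r) v (memory a [] [] [] ρ) (7 * l.length + 4) Q := by
  refine (Ends.seq (Ends.drain (l := l) (x := some) (T := 2)
    -- The flag always holds the last symbol read, or the initial flag; the symbols before it have
    -- been written. The register thus loses its last bit and gains the flag in front.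
    (fun l₁ _ => (v.2.2 :: l₁).getLast (by simp))
    (fun l₁ l₂ => memory a [] (bits (v.2.2 :: l₁).dropLast.reverse id) []
      (Function.update ρ r (bits l₂ id)))
    ?_ ?_ rfl ?_ fun _ _ => Ends.move (by simp) fun _ _ => ?_)).le ?_
  · simp [bits]
  · intro l₁ i l₂ y' _
    refine Ends.seq (Ends.push (Ends.load ⟨?_, ?_⟩))
    · exact (List.getLast_concat (l := v.2.2 :: l₁)).symm
    · have h : (v.2.2 :: (l₁ ++ [i])).dropLast.reverse = (v.2.2 :: l₁).getLast (by simp) ::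
          (v.2.2 :: l₁).dropLast.reverse := by
        rw [← List.cons_append, List.dropLast_concat]
        conv_lhs => rw [← List.dropLast_append_getLast (l := v.2.2 :: l₁) (by simp)]
        simp
      simp [h, bits]
  · simp [← hr]
  · convert hQ _ _ using 1
    simp
  · simp
    omega

@[simp] theorem rows_nil {α β : Type*} (l : List β) (M : α → β → Bool) : rows [] l M = [] := rfl
@[simp] theorem rows_cons {α β : Type*} (i : α) (l : List α) (l' : List β) (M : α → β → Bool) :
    rows (i :: l) l' M = bits l' (M i) ++ none :: rows l l' M := by simp [rows]
@[simp] theorem rows_append {α β : Type*} (l₁ l₂ : List α) (l' : List β) (M : α → β → Bool) :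
    rows (l₁ ++ l₂) l' M = rows l₁ l' M ++ rows l₂ l' M := List.flatMap_append

theorem length_rows {α β : Type*} (l : List α) (l' : List β) (M : α → β → Bool) :
    (rows l l' M).length = l.length * (l'.length + 1) := by
  induction l with
  | nil => simp
  | cons i l ih => simp [ih]; ring

/-- The old contents of `r` only count the rows. For each row, `s` is drained in step with the
matrix entries and then restored. The part of the matrix already read is kept on the second stack
and moved back at the end. -/
theorem ends_mulReg {M : α → α → Bool} (hrs : r ≠ s) (hr : ρ r = bits l x)
    (hs : ρ s = bits l y) (hQ : ∀ v', Q v' (memory (rows l l M) [] [] []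
      (Function.update ρ r (bits l fun i => l.any fun j => M i j && y j)))) :
    Ends (mulReg r s) v (memory (rows l l M) [] [] [] ρ)
      ((13 * l.length + 14) * (l.length + 1)) Q := by
  refine (Ends.seq (Ends.load (Ends.seq (Ends.drain (l := l) (x := fun i => some (x i))
    (T := 9 * l.length + 8) (fun _ _ => false)
    (fun l₁ l₂ => memory (rows l₂ l M) (rows l₁ l M).reverse []
      (bits l₁.reverse fun i => l.any fun j => M i j && y j) (Function.update ρ r (bits l₂ x)))
    ?_ ?_ rfl ?_ fun _ _ => Ends.seq (Ends.move (by simp) fun _ _ => Ends.move (by simp)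
        fun _ _ => ?_))))).le ?_
  · simp
  · intro l₁ i l₂ y' _
    refine (Ends.seq (Ends.drain (l := l) (x := fun i => some (y i)) (T := 4)
      -- The flag is the partial scalar product of row `i` with `y`; it is reset after each row.
      (fun l₃ _ => l₃.any fun j => M i j && y j)
      (fun l₃ l₄ => memory (bits l₄ (M i) ++ none :: rows l₂ l M)
        ((bits l₃ (M i)).reverse ++ (rows l₁ l M).reverse) (bits l₃.reverse y)
        (bits l₁.reverse fun i => l.any fun j => M i j && y j)
        (Function.update (Function.update ρ r (bits l₂ x)) s (bits l₄ y)))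
      ?_ ?_ rfl ?_ fun _ _ => Ends.seq (Ends.push (Ends.seq (Ends.pop (Ends.seq (Ends.push
        (Ends.seq (T₁ := 3 * l.length + 2) (T₂ := 1)
        ((Ends.move ?_ fun _ _ => Ends.load ?_).le ?_))))))))).le ?_
    · simp
    · intro l₃ j l₄ y'' _
      exact Ends.seq (Ends.pop (Ends.seq (Ends.load (Ends.seq (Ends.push (Ends.push
        (by simp)))))))
    · simp only [bits_cons, rows_cons, map_some_eq_bits, update_memory_inr, bits_nil,
        List.reverse_nil, List.nil_append, Function.update_idem, ← hs]
      congr 1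
      funext j
      by_cases h₁ : j = r <;> by_cases h₂ : j = s <;> simp_all
    · simp
    · refine ⟨rfl, ?_⟩
      simp only [update_memory_inr, update_memory_zero, update_memory_one, update_memory_two,
        update_memory_three, memory_zero, memory_one, memory_two, memory_three, memory_inr]
      congr 1
      · simp
      · simp
      · simp [Function.update_of_ne hrs.symm, hs]
    · simp
    · simp
      omega
  · simp [← hr]
  · convert hQ _ using 1
    simp
  · simp [length_rows]
    ring_nf
    omega

/-- The `k`-th vector in the sequence of the zero vector and the indicator vectors of the
indices. -/
def shiftVec {n : ℕ} (k : ℕ) (i : Fin n) : Bool := decide (i.val + 1 = k)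

@[simp] theorem shiftVec_zero {n : ℕ} : (shiftVec 0 : Fin n → Bool) = fun _ => false := by
  funext i
  simp [shiftVec]

/-- A one enters from the flag only in the shift from `k = 0`; later shifts push zeros and move the
one along. -/
theorem dropLast_shiftVec {n k : ℕ} :
    (decide (k = 0) :: (List.finRange n).map (shiftVec k)).dropLast =
      (List.finRange n).map (shiftVec (k + 1)) := by
  refine List.ext_getElem (by simp) fun i h₁ h₂ => ?_
  rcases i with _ | i
  · simp [shiftVec]
  · simp [shiftVec]

/-- The bit shifted out is the one exactly when the last index has been passed, which is the exit
condition of the loop. For `n = 0` the initial one falls out at once. -/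
theorem getLast_shiftVec {n k : ℕ} (hk : k ≤ n) :
    (decide (k = 0) :: (List.finRange n).map (shiftVec k)).getLast (by simp) =
      decide (k = n) := by
  rcases n with _ | n
  · simp
  · rw [List.getLast_eq_getElem]
    simp [shiftVec, eq_comm]

theorem ends_shiftReg_shiftVec {n k : ℕ} (hk : k ≤ n) (hv : v.2.2 = decide (k = 0))
    (hr : ρ r = bits (List.finRange n) (shiftVec k))
    (hQ : ∀ x y, Q (x, y, decide (k = n)) (memory a [] [] []
      (Function.update ρ r (bits (List.finRange n) (shiftVec (k + 1)))))) :
    Ends (shiftReg r) v (memory a [] [] [] ρ) (7 * n + 4) Q := by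
  refine (ends_shiftReg (l := (List.finRange n).map (shiftVec k)) (by simp [hr])
    fun x y => ?_).le (by simp)
  simp only [hv, dropLast_shiftVec, getLast_shiftVec hk]
  simpa using hQ x y

/-- `St k` describes the registers before pass `k`, when `r` already holds the indicator of the
index `k`, that is `shiftVec (k + 1)`. The pass must preserve `r`, because the following shift
computes the next index from it. -/
theorem ends_forReg {n T : ℕ} {p : RegProg ι} {x : Fin n → Bool} (St : ℕ → ι → List Sym)
    (hr : ρ r = bits (List.finRange n) x)
    (h₀ : Function.update ρ r (bits (List.finRange n) (shiftVec 1)) = St 0)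
    (hp : ∀ k < n, ∀ v, Ends p v (memory a [] [] [] (St k)) T fun _ S' =>
      ∃ ρ', S' = memory a [] [] [] ρ' ∧ ρ' r = bits (List.finRange n) (shiftVec (k + 1)) ∧
        Function.update ρ' r (bits (List.finRange n) (shiftVec (k + 2))) = St (k + 1))
    (hQ : ∀ v, Q v (memory a [] [] [] (St n))) :
    Ends (forReg r p) v (memory a [] [] [] ρ) ((T + 7 * n + 6) * n + 13 * n + 10) Q := by
  have loop : ∀ m k, k + m = n → ∀ x y, Ends (.while (fun v => !v.2.2)
      (StackProg.seq p (StackProg.seq (setFlag fun _ => false) (shiftReg r))))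
      (x, y, decide (k = n)) (memory a [] [] [] (St k)) ((T + 7 * n + 6) * m + 1) Q := by
    intro m
    induction m with
    | zero =>
      intro k hk x y
      obtain rfl : k = n := by simpa using hk
      exact (Ends.while_false (by simp) (hQ _)).le (by omega)
    | succ m ih =>
      intro k hk x y
      refine (Ends.while_true (c := fun v => !v.2.2) (T₂ := (T + 7 * n + 6) * m + 1)
        ?_ (Ends.seq (T₂ := 7 * n + 5) ((hp k (by omega) _).imp ?_))).le ?_
      · simp
        omega
      · rintro v' _ ⟨ρ', rfl, h₁, h₂⟩
        refine (Ends.seq (Ends.load (ends_shiftReg_shiftVec (k := k + 1) (n := n) (by omega)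
          (by simp) h₁ fun x y => ?_))).le (by omega)
        rw [h₂]
        exact ih (k + 1) (by omega) x y
      · ring_nf
        omega
  refine (Ends.seq (ends_zeroReg hr fun v' => Ends.seq (Ends.load (Ends.seq
    (T₂ := (T + 7 * n + 6) * n + 1)
    (ends_shiftReg_shiftVec (n := n) (k := 0) (by omega) (by simp) ?_ fun x y => ?_))))).le ?_
  · simp
  · simp only [Function.update_idem, zero_add, h₀]
    exact loop n 0 (by omega) x y
  · simp
    omega

end Registers

end StackProg

/-! ### Vector programs and their implementation by register programs. -/

/-- Programs that compute with Boolean vectors in registers, where the length `n` of the vectors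
and an `n × n` matrix are given as input. -/
inductive VecProg : Type
  | zip (f : Bool → Bool → Bool) (r s : ℕ)
  | any (r : ℕ)
  | mul (r s : ℕ)
  | forEach (r : ℕ) (p : VecProg)
  | seq (p q : VecProg)

namespace VecProg

open StackProg

/-- The contents of the registers after the execution of a program. -/
def run {n : ℕ} (M : Fin n → Fin n → Bool) : VecProg → (ℕ → Fin n → Bool) → ℕ → Fin n → Bool
  | zip f r s, st => Function.update st r fun i => f (st r i) (st s i)
  | any r, st => Function.update st r fun _ => (List.finRange n).any (st r)
  | mul r s, st => Function.update st r fun i => (List.finRange n).any fun j => M i j && st s j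
  | forEach r p, st => Function.update
      ((List.finRange n).foldl (fun st i => run M p (Function.update st r fun j => decide (j = i)))
        st) r fun _ => false
  | seq p q, st => run M q (run M p st)

/-- The program `p` may change the register `r`. -/
def Writes (r : ℕ) : VecProg → Prop
  | zip _ r' _ => r = r'
  | any r' => r = r'
  | mul r' _ => r = r'
  | forEach r' p => r = r' ∨ Writes r p
  | seq p q => Writes r p ∨ Writes r q

/-- The operations of the program have different registers as operands, its loops do not change
their loop variables, and all its registers are at most `N`. -/
def WF (N : ℕ) : VecProg → Prop
  | zip _ r s => r ≠ s ∧ r ≤ N ∧ s ≤ N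
  | any r => r ≤ N
  | mul r s => r ≠ s ∧ r ≤ N ∧ s ≤ N
  | forEach r p => ¬ Writes r p ∧ r ≤ N ∧ WF N p
  | seq p q => WF N p ∧ WF N q

/-- A bound for the number of steps in terms of the length of the vectors. -/
noncomputable def time : VecProg → Polynomial ℕ
  | zip _ _ _ => 11 * .X + 6
  | any _ => 7 * .X + 5
  | mul _ _ => (13 * .X + 14) * (.X + 1)
  | forEach _ p => (time p + 7 * .X + 6) * .X + 13 * .X + 10
  | seq p q => time p + time q

theorem run_of_not_writes {n : ℕ} (M : Fin n → Fin n → Bool) {r : ℕ} :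
    ∀ {p : VecProg}, ¬ Writes r p → ∀ st, run M p st r = st r
  | zip _ _ _, h, st => Function.update_of_ne h _ _
  | any _, h, st => Function.update_of_ne h _ _
  | mul _ _, h, st => Function.update_of_ne h _ _
  | forEach r' p, h, st => by
    simp only [Writes, not_or] at h
    rw [run, Function.update_of_ne h.1]
    generalize List.finRange n = l
    induction l generalizing st with
    | nil => rfl
    | cons i l ih =>
      rw [List.foldl_cons, ih, run_of_not_writes M h.2, Function.update_of_ne h.1]
  | seq p q, h, st => by
    simp only [Writes, not_or] at h
    rw [run, run_of_not_writes M h.2, run_of_not_writes M h.1]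

/-- The implementation of a program by a program for stacks. -/
def toRegProg (N : ℕ) : VecProg → RegProg (Fin (N + 1))
  | zip f r s => zipReg f (Fin.ofNat (N + 1) r) (Fin.ofNat (N + 1) s)
  | any r => anyReg (Fin.ofNat (N + 1) r)
  | mul r s => mulReg (Fin.ofNat (N + 1) r) (Fin.ofNat (N + 1) s)
  | forEach r p => forReg (Fin.ofNat (N + 1) r) (toRegProg N p)
  | seq p q => .seq (toRegProg N p) (toRegProg N q)

section Registers

variable {n : ℕ} (M : Fin n → Fin n → Bool) {N r s : ℕ} (st : ℕ → Fin n → Bool)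

/-- The stacks that hold the contents of the registers. -/
def registers (N : ℕ) (j : Fin (N + 1)) : List Sym := bits (List.finRange n) (st j)

theorem val_ofNat (hr : r ≤ N) : (Fin.ofNat (N + 1) r).val = r := by
  simp [Nat.mod_eq_of_lt (Nat.lt_succ_of_le hr)]

theorem ofNat_ne (hrs : r ≠ s) (hr : r ≤ N) (hs : s ≤ N) :
    Fin.ofNat (N + 1) r ≠ Fin.ofNat (N + 1) s := by
  rw [Ne, Fin.ext_iff, val_ofNat hr, val_ofNat hs]
  exact hrs

theorem registers_ofNat (hr : r ≤ N) :
    registers st N (Fin.ofNat (N + 1) r) = bits (List.finRange n) (st r) := by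
  rw [registers, val_ofNat hr]

theorem update_registers (hr : r ≤ N) (x : Fin n → Bool) :
    Function.update (registers st N) (Fin.ofNat (N + 1) r) (bits (List.finRange n) x) =
      registers (Function.update st r x) N := by
  funext j
  by_cases h : j = Fin.ofNat (N + 1) r
  · subst h
    rw [Function.update_self, registers_ofNat _ hr, Function.update_self]
  · rw [Function.update_of_ne h, registers, registers, Function.update_of_ne]
    rintro rfl
    exact h (Fin.ext (val_ofNat hr).symm)

theorem shiftVec_succ (i : Fin n) :
    (shiftVec (i + 1) : Fin n → Bool) = fun j => decide (j = i) := by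
  funext j
  simp [shiftVec, Fin.ext_iff]

theorem shiftVec_last : (shiftVec (n + 1) : Fin n → Bool) = fun _ => false := by
  funext j
  simp [shiftVec, j.isLt.ne]

/-- The time is measured in any `L ≥ n`, so that `L` can later be the length of the input word. -/
theorem ends_toRegProg {L : ℕ} (hL : n ≤ L) : ∀ (p : VecProg), p.WF N →
    ∀ (v : Control) (st : ℕ → Fin n → Bool),
    Ends (toRegProg N p) v
      (memory (rows (List.finRange n) (List.finRange n) M) [] [] [] (registers st N))
      (p.time.eval L)
      fun _ S => S = memory (rows (List.finRange n) (List.finRange n) M) [] [] []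
        (registers (run M p st) N)
  | zip f r s, h, v, st => by
    refine (ends_zipReg (ofNat_ne h.1 h.2.1 h.2.2) (registers_ofNat _ h.2.1)
      (registers_ofNat _ h.2.2) fun v' => ?_).le ?_
    · rw [update_registers _ h.2.1]
      rfl
    · simp [time]
      omega
  | any r, h, v, st => by
    refine (ends_anyReg (registers_ofNat _ h) fun v' => ?_).le ?_
    · rw [update_registers _ h]
      rfl
    · simp [time]
      omega
  | mul r s, h, v, st => by
    refine (ends_mulReg (ofNat_ne h.1 h.2.1 h.2.2) (registers_ofNat _ h.2.1)
      (registers_ofNat _ h.2.2) fun v' => ?_).le ?_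
    · rw [update_registers _ h.2.1]
      rfl
    · simp [time]
      gcongr
  | forEach r p, h, v, st => by
    set F : (ℕ → Fin n → Bool) → Fin n → ℕ → Fin n → Bool :=
      fun st i => run M p (Function.update st r fun j => decide (j = i)) with hF
    -- Before pass `k` the state is the fold over the first `k` indices, with the next indicator
    -- loaded. After the last shift the loop register is zero, in agreement with the reset in `run`.
    refine (ends_forReg (T := p.time.eval L) (fun k => registers (Function.update
      (((List.finRange n).take k).foldl F st) r (shiftVec (k + 1))) N)
      (registers_ofNat _ h.2.1) ?_ ?_ ?_).le ?_
    · rw [update_registers _ h.2.1]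
      simp
    · intro k hk v
      refine (ends_toRegProg hL p h.2.2 v _).imp ?_
      rintro v' _ rfl
      refine ⟨_, rfl, ?_, ?_⟩
      · rw [registers_ofNat _ h.2.1, run_of_not_writes M h.1, Function.update_self]
      · rw [update_registers _ h.2.1]
        congr 2
        have := shiftVec_succ ⟨k, hk⟩
        simp only at this
        rw [List.take_succ_eq_append_getElem (by simpa using hk), List.foldl_append, this]
        simp [hF]
    · intro v
      simp only [shiftVec_last]
      rw [List.take_of_length_le (by simp)]
      rfl
    · simp only [time, Polynomial.eval_add, Polynomial.eval_mul, Polynomial.eval_X,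
        Polynomial.eval_ofNat]
      gcongr
  | seq p q, h, v, st => by
    simp only [time, Polynomial.eval_add]
    refine Ends.seq ((ends_toRegProg hL p h.1 v st).imp ?_)
    rintro v' _ rfl
    exact ends_toRegProg hL q h.2 v' _

end Registers

end VecProg

/-! ### Clean-up, initialization, and the complete machine. -/

namespace StackProg

open Turing

section Cleanup

variable {K : Type} [DecidableEq K]

/-- Empty the given stacks. -/
def clear : List K → StackProg K Sym Control
  | [] => load id
  | k :: l => seq (drain k (load id)) (clear l)

theorem ends_clear {Q : Control → (K → List Sym) → Prop} {L : ℕ} (l : List K) {v : Control}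
    {S : K → List Sym} (hL : ∀ k ∈ l, (S k).length ≤ L)
    (hQ : ∀ x y, Q (x, y, v.2.2) fun k => if k ∈ l then [] else S k) :
    Ends (clear l) v S ((3 * L + 2) * l.length + 1) Q := by
  induction l generalizing v S with
  | nil => exact (Ends.load (by simpa using hQ v.1 v.2.1)).le (by simp)
  | cons k l ih =>
    refine (Ends.seq (T₁ := 3 * L + 2) (T₂ := (3 * L + 2) * l.length + 1)
      ((Ends.drain (l := S k) (x := id) (T := 1) (fun _ _ => v.2.2)
        (fun _ l => Function.update S k l) ?_ ?_ rfl ?_ fun x y => ?_).le ?_)).le ?_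
    · simp
    · intro l₁ i l₂ y _
      exact Ends.load (by simp)
    · simp
    · refine ih (fun k' hk' => ?_) fun x y => ?_
      · by_cases h : k' = k
        · simp [h]
        · rw [Function.update_of_ne h]
          exact hL k' (List.mem_cons_of_mem _ hk')
      · convert hQ x y using 1
        funext k'
        by_cases h : k' = k <;> by_cases h' : k' ∈ l <;> simp [h, h']
    · have := hL k List.mem_cons_self
      omega
    · simp only [List.length_cons]
      ring_nf
      omega

end Cleanup

section Init

variable {ι : Type}

/-- Push a zero on each of the given registers. -/
def pushZeros : List ι → RegProg ι
  | [] => load id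
  | r :: l => seq (push (Sum.inr r) fun _ => some false) (pushZeros l)

/-- Fill the given registers with as many zeros as there are bits in the first row of the input. -/
def initRegs (l : List ι) : RegProg ι :=
  seq (setFlag fun _ => true)
    (seq (drain (Sum.inl 0) (seq (ite (fun v => (v.1.getD none).isNone) (setFlag fun _ => false)
        (ite (fun v => v.2.2) (pushZeros l) (load id)))
        (push (Sum.inl 1) fun v => v.1.getD none)))
      (move (Sum.inl 1) (Sum.inl 0)))

variable [DecidableEq ι] {v : Control} {a b c d : List Sym}
  {Q : Control → (Fin 4 ⊕ ι → List Sym) → Prop}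

theorem ends_pushZeros {l : List ι} (hl : l.Nodup) {ρ : ι → List Sym}
    (hQ : Q v (memory a b c d fun r => if r ∈ l then some false :: ρ r else ρ r)) :
    Ends (pushZeros l) v (memory a b c d ρ) (l.length + 1) Q := by
  induction l generalizing ρ with
  | nil => exact (Ends.load (by simpa using hQ)).le (by simp)
  | cons r l ih =>
    refine (Ends.seq (T₂ := l.length + 1) (Ends.push ?_)).le (by simp; omega)
    rw [update_memory_inr]
    refine ih hl.of_cons ?_
    convert hQ using 2
    funext r'
    have := hl.notMem
    by_cases h : r' = r <;> by_cases h' : r' ∈ l <;> simp_all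

theorem length_takeWhile_concat {α : Type*} (p : α → Bool) (l : List α) (i : α) :
    ((l ++ [i]).takeWhile p).length =
      (l.takeWhile p).length + if l.all p = true ∧ p i = true then 1 else 0 := by
  induction l with
  | nil => cases h : p i <;> simp [h]
  | cons a l ih =>
    cases h : p a
    · simp [h]
    · simp [h, ih]
      omega

/-- The flag records that no end-of-row symbol has been read yet, so one zero is pushed on every
register for each bit of the first row. This is how the machine learns `n`. -/
theorem ends_initRegs {l : List ι} (hl : l.Nodup) (hl' : ∀ r, r ∈ l)
    (hQ : ∀ v, Q v (memory a [] [] [] fun _ =>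
      List.replicate (a.takeWhile Option.isSome).length (some false))) :
    Ends (initRegs l) v (memory a [] [] [] fun _ => []) ((l.length + 11) * a.length + 5) Q := by
  refine (Ends.seq (Ends.load (Ends.seq (Ends.drain (l := a) (x := id) (T := l.length + 6)
    (fun l₁ _ => l₁.all Option.isSome)
    (fun l₁ l₂ => memory l₂ l₁.reverse [] [] fun _ =>
      List.replicate (l₁.takeWhile Option.isSome).length (some false))
    ?_ ?_ rfl ?_ fun _ _ => Ends.move (by simp) fun _ _ => ?_)))).le ?_
  · simp
  · intro l₁ i l₂ y _
    refine (Ends.seq (T₂ := 1)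
      (Ends.ite (T₁ := 1) (T₂ := l.length + 3) (fun h => ?_) fun h => ?_)).le
      (by omega)
    · obtain rfl : i = none := by simpa using h
      refine Ends.load (Ends.push ?_)
      simp [length_takeWhile_concat]
    · obtain ⟨b, rfl⟩ : ∃ b, i = some b := by
        rcases i with _ | b
        · simp at h
        · exact ⟨b, rfl⟩
      refine (Ends.ite (T₁ := l.length + 1) (T₂ := 1) (fun h => ?_) fun h => ?_).le (by omega)
      · rw [id, List.map_id, update_memory_zero]
        refine ends_pushZeros hl (Ends.push ?_)
        simp only at h
        simp [length_takeWhile_concat, hl', h, List.replicate_succ, -List.all_eq_true]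
      · refine Ends.load (Ends.push ?_)
        simp only at h
        simp [length_takeWhile_concat, h, -List.all_eq_true, -List.all_eq_false]
  · simp
  · convert hQ _ using 1
    simp
  · simp
    ring_nf
    omega

end Init

section Machine

/-- The machine that runs a program, then pushes the flag on the output stack and halts in the
initial control state. -/
noncomputable def machine {K : Type} [DecidableEq K] [Fintype K] (inp : K)
    (p : StackProg K Sym Control) : FinTM2 where
  K := Option K
  k₀ := some inp
  k₁ := none
  Γ := Alphabet K Sym Bool
  Λ := Option (Label p)
  main := some (entry p)
  ΛFin := letI := Label.fintype p; inferInstanceAs (Fintype (Option (Label p)))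
  σ := Control
  initialState := (none, none, false)
  Γk₀Fin := inferInstanceAs (Fintype Sym)
  m l := l.elim (.push none (fun v : Control => v.2.2) (.load (fun _ => (none, none, false)) .halt))
    (code p some none)

/-- The required halting configuration has the initial control state and nothing but the answer on
the stacks; hence the program has to empty all its stacks. The additional step pushes the flag on
the output stack, resets the control and halts. -/
theorem iterate_machine {K : Type} [DecidableEq K] [Fintype K] {inp : K}
    {p : StackProg K Sym Control} {l : List Sym} {b : Bool} {T : ℕ}
    (h : Ends p (none, none, false) (Function.update (fun _ => []) inp l) T
      fun v S => v.2.2 = b ∧ S = fun _ => []) :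
    Nonempty (TM2OutputsInTime (machine inp p) l (some [b]) (T + 1)) := by
  obtain ⟨⟨x, y, c⟩, _, t, h, ht, rfl, rfl⟩ := h
  have h' := h.iterate (M := (machine inp p).m) some none fun l => rfl
  refine ⟨⟨⟨t + 1, ?_⟩, Nat.add_le_add_right ht 1⟩⟩
  rw [add_comm, Function.iterate_add_apply]
  have h₀ : initList (machine inp p) l = ⟨some (some (entry p)), (none, none, false),
      extend (Function.update (fun _ => []) inp l)⟩ := by
    simp only [initList]
    congr 1
    funext k
    rcases k with _ | k
    · rfl
    · by_cases h : k = inp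
      · subst h
        simp [extend, machine]
        rfl
      · simp [extend, machine, h]
  rw [h₀]
  refine (congrArg _ h').trans ?_
  rw [Function.iterate_one]
  have h₁ : (⟨none, (none, none, false), Function.update (extend (B := Bool) fun _ : K => [])
      none [c]⟩ : (machine inp p).Cfg) = haltList (machine inp p) [c] := by
    simp only [haltList]
    congr 1
    funext k
    rcases k with _ | k
    · simp [machine]
      rfl
    · simp [machine]
      rfl
  exact congrArg some h₁

end Machine

section VecProg

/-- Run a program for vectors on the input, read the flag off the register `0`, and empty all
stacks. -/
noncomputable def ofVecProg (N : ℕ) (p : VecProg) : RegProg (Fin (N + 1)) :=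
  seq (initRegs (List.finRange (N + 1))) (seq (p.toRegProg N) (seq (setFlag fun _ => false)
    (seq (drain (Sum.inr 0) (setFlag fun v => v.2.2 || bit v.1))
      (clear (Finset.univ : Finset (Fin 4 ⊕ Fin (N + 1))).toList))))

theorem length_takeWhile_rows {n : ℕ} (M : Fin n → Fin n → Bool) :
    ((rows (List.finRange n) (List.finRange n) M).takeWhile Option.isSome).length = n := by
  rcases n with _ | n
  · simp
  · rw [List.finRange_succ, rows_cons, List.takeWhile_append_of_pos]
    · simp
    · intro a ha
      obtain ⟨i, -, rfl⟩ := List.mem_map.1 ha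
      rfl

theorem ends_ofVecProg {N n L : ℕ} {p : VecProg} (hp : p.WF N) (M : Fin n → Fin n → Bool)
    (hL : (rows (List.finRange n) (List.finRange n) M).length = L) :
    Ends (ofVecProg N p) (none, none, false) (Function.update (fun _ => []) (Sum.inl 0)
        (rows (List.finRange n) (List.finRange n) M))
      ((N + 12) * L + 5 + (p.time.eval L + (1 + (4 * L + 2 + ((3 * L + 2) * (N + 5) + 1)))))
      fun v S => v.2.2 = (List.finRange n).any (p.run M (fun _ _ => false) 0) ∧
        S = fun _ => [] := by
  have hn : n ≤ L := by
    rw [← hL, length_rows, List.length_finRange]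
    exact Nat.le_mul_of_pos_right _ n.succ_pos
  have h₀ : Function.update (fun _ => []) (Sum.inl 0)
        (rows (List.finRange n) (List.finRange n) M) =
      memory (rows (List.finRange n) (List.finRange n) M) [] [] [] fun _ : Fin (N + 1) => [] := by
    rw [← update_memory_zero (a := [])]
    congr 1
    funext j
    rcases j with j | j
    · fin_cases j <;> rfl
    · rfl
  rw [h₀]
  refine Ends.seq ((ends_initRegs (List.nodup_finRange _) List.mem_finRange fun v => ?_).le ?_)
  · have h₁ : (fun _ => List.replicate ((rows (List.finRange n) (List.finRange n) M).takeWhile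
        Option.isSome).length (some false)) = VecProg.registers (fun _ (_ : Fin n) => false) N := by
      funext j
      rw [length_takeWhile_rows]
      simp [VecProg.registers, bits_const]
    rw [h₁]
    refine Ends.seq ((VecProg.ends_toRegProg M hn p hp v _).imp ?_)
    rintro v _ rfl
    refine Ends.seq (Ends.load (Ends.seq ((Ends.drain (l := List.finRange n)
      (x := fun i => some (p.run M (fun _ _ => false) 0 i)) (T := 2)
      (fun l _ => l.any (p.run M (fun _ _ => false) 0))
      (fun _ l => memory (rows (List.finRange n) (List.finRange n) M) [] [] [] (Function.update
        (VecProg.registers (p.run M fun _ _ => false) N) 0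
        (bits l (p.run M (fun _ _ => false) 0)))) ?_ ?_ rfl ?_ fun x y =>
        (ends_clear _ (L := L) ?_ fun x y => ?_).le ?_).le ?_)))
    · simp
    · intro l₁ i l₂ y _
      exact (Ends.load (by simp)).le (by omega)
    · have h₂ : bits (List.finRange n) (p.run M (fun _ _ => false) 0) =
        VecProg.registers (p.run M fun _ _ => false) N 0 := rfl
      rw [h₂, Function.update_eq_self]
    · intro k _
      rcases k with k | k
      · fin_cases k <;> simp [hL]
      · rw [memory_inr, Function.update_apply]
        split_ifs
        · simp
        · simpa [VecProg.registers] using hn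
    · simp
    · simp
      ring_nf
      omega
    · simp
      omega
  · simp [hL]

theorem decidableInPolyTime_of_vecProg {α : Type} {encode : α → List Sym} {P : α → Prop}
    {n : α → ℕ} {M : ∀ a, Fin (n a) → Fin (n a) → Bool} {N : ℕ} {p : VecProg} (hp : p.WF N)
    (henc : ∀ a, encode a = rows (List.finRange (n a)) (List.finRange (n a)) (M a))
    (hP : ∀ a, P a ↔ ∃ i, p.run (M a) (fun _ _ => false) 0 i = true) :
    PartialCubes.DecidableInPolyTime encode P := by
  classical
  refine ⟨⟨⟨machine (Sum.inl 0) (ofVecProg N p), Equiv.refl _, Equiv.refl _⟩,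
    ((N : Polynomial ℕ) + 12) * .X + 5 +
      (p.time + (1 + (4 * .X + 2 + ((3 * .X + 2) * (N + 5) + 1))))
      + 1, fun a => Classical.choice ?_⟩⟩
  have h := iterate_machine (ends_ofVecProg hp (M a) (congrArg List.length (henc a).symm))
  have h' : (List.finRange (n a)).any (p.run (M a) (fun _ _ => false) 0) = decide (P a) := by
    rw [Bool.eq_iff_iff, List.any_eq_true, decide_eq_true_iff, hP]
    simp
  rw [h', ← henc] at h
  -- The input word is mapped through the bijection of alphabets, here the identity. The word is
  -- generalized so that `List.map_id` can be applied.
  have hl : ∀ T l, l = encode a → Nonempty (TM2OutputsInTime (machine (Sum.inl 0) (ofVecProg N p))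
      (encode a) (some [decide (P a)]) T) → Nonempty (TM2OutputsInTime
      (machine (Sum.inl 0) (ofVecProg N p)) l (some [decide (P a)]) T) := by
    rintro T _ rfl
    exact id
  simp only [Polynomial.eval_add, Polynomial.eval_mul, Polynomial.eval_X, Polynomial.eval_ofNat,
    Polynomial.eval_natCast, Polynomial.eval_one, Nat.cast_id]
  exact hl _ _ (List.map_id _) h

end VecProg

end StackProg

/-! ### Expressions with quantifiers over vertices, and their compilation. -/

/-- Expressions for Boolean vectors, with variables that range over the indicator vectors of the
indices. -/
inductive VecExpr : Type
  | var (i : ℕ)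
  | op (f : Bool → Bool → Bool) (e₁ e₂ : VecExpr)
  | mul (e : VecExpr)
  | any (e : VecExpr)
  | ex (e : VecExpr)
  | half (e₁ e₂ : VecExpr)

namespace VecExpr

open VecProg

section Semantics

variable {n : ℕ} (M : Fin n → Fin n → Bool)

/-- The product of a matrix and a vector. -/
def prod (x : Fin n → Bool) (i : Fin n) : Bool := (List.finRange n).any fun j => M i j && x j

/-- The indices from which `x` is reached in at most `k` steps. -/
def ball (x : Fin n → Bool) : ℕ → Fin n → Bool
  | 0 => x
  | k + 1 => fun i => ball x k i || prod M (ball x k) i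

/-- The value of an expression, where `d` is the index of the next variable to be bound. -/
def eval : ℕ → (ℕ → Fin n → Bool) → VecExpr → Fin n → Bool
  | _, ρ, var i => ρ i
  | d, ρ, op f e₁ e₂ => fun i => f (eval d ρ e₁ i) (eval d ρ e₂ i)
  | d, ρ, mul e => prod M (eval d ρ e)
  | d, ρ, any e => fun _ => (List.finRange n).any (eval d ρ e)
  | d, ρ, ex e => fun i => (List.finRange n).any fun v =>
      eval (d + 1) (Function.update ρ d fun j => decide (j = v)) e i
  | d, ρ, half e₁ e₂ => fun i => (List.range n).any fun k =>
      ball M (eval d ρ e₁) k i && !ball M (eval d ρ e₂) k i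

end Semantics

/-- Copy a register. -/
def copy (r s : ℕ) : VecProg := .zip (fun _ b => b) r s

/-- One step of the computation of a halfspace. -/
def halfStep (t : ℕ) : VecProg :=
  .seq (copy (2 * (t + 4) + 1) (2 * t + 1))
    (.seq (.zip (fun a b => a && !b) (2 * (t + 4) + 1) (2 * (t + 1) + 1))
      (.seq (.zip or (2 * (t + 2) + 1) (2 * (t + 4) + 1))
        (.seq (.mul (2 * (t + 4) + 1) (2 * t + 1))
          (.seq (.zip or (2 * t + 1) (2 * (t + 4) + 1))
            (.seq (.mul (2 * (t + 4) + 1) (2 * (t + 1) + 1))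
              (.zip or (2 * (t + 1) + 1) (2 * (t + 4) + 1)))))))

/-- A program that writes the value of an expression to the register `2 * t + 1`. It uses the
registers `2 * i` for the variables, and registers `2 * j + 1` with `t ≤ j` for intermediate
results. -/
def toVecProg : ℕ → ℕ → VecExpr → VecProg
  | _, t, var i => copy (2 * t + 1) (2 * i)
  | d, t, op f e₁ e₂ => .seq (toVecProg d t e₁) (.seq (toVecProg d (t + 1) e₂)
      (.zip f (2 * t + 1) (2 * (t + 1) + 1)))
  | d, t, mul e => .seq (toVecProg d (t + 1) e) (.mul (2 * t + 1) (2 * (t + 1) + 1))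
  | d, t, any e => .seq (toVecProg d t e) (.any (2 * t + 1))
  | d, t, ex e => .seq (.zip (fun _ _ => false) (2 * t + 1) (2 * (t + 1) + 1))
      (.forEach (2 * d) (.seq (toVecProg (d + 1) (t + 1) e)
        (.zip or (2 * t + 1) (2 * (t + 1) + 1))))
  | d, t, half e₁ e₂ => .seq (toVecProg d t e₁) (.seq (toVecProg d (t + 1) e₂)
      (.seq (.zip (fun _ _ => false) (2 * (t + 2) + 1) (2 * t + 1))
        (.seq (.forEach (2 * (t + 3) + 1) (halfStep t)) (copy (2 * t + 1) (2 * (t + 2) + 1)))))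

/-- Variables occupy even registers and intermediate results odd ones. With this discipline a
subexpression compiled at level `t + 1` cannot destroy the result held at level `t`, nor one below
the binder `d` its loop variable. -/
theorem writes_toVecProg {r : ℕ} : ∀ {d t : ℕ} {e : VecExpr}, Writes r (toVecProg d t e) →
    (∃ i, d ≤ i ∧ r = 2 * i) ∨ ∃ j, t ≤ j ∧ r = 2 * j + 1
  | d, t, var i, h => .inr ⟨t, le_rfl, h⟩
  | d, t, op f e₁ e₂, h => by
    rcases h with h | h | h
    · exact writes_toVecProg h
    · rcases writes_toVecProg h with h | ⟨j, hj, rfl⟩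
      · exact .inl h
      · exact .inr ⟨j, by omega, rfl⟩
    · exact .inr ⟨t, le_rfl, h⟩
  | d, t, mul e, h => by
    rcases h with h | h
    · rcases writes_toVecProg h with h | ⟨j, hj, rfl⟩
      · exact .inl h
      · exact .inr ⟨j, by omega, rfl⟩
    · exact .inr ⟨t, le_rfl, h⟩
  | d, t, any e, h => by
    rcases h with h | h
    · exact writes_toVecProg h
    · exact .inr ⟨t, le_rfl, h⟩
  | d, t, ex e, h => by
    rcases h with h | h | h | h
    · exact .inr ⟨t, le_rfl, h⟩
    · exact .inl ⟨d, le_rfl, h⟩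
    · rcases writes_toVecProg h with ⟨i, hi, rfl⟩ | ⟨j, hj, rfl⟩
      · exact .inl ⟨i, by omega, rfl⟩
      · exact .inr ⟨j, by omega, rfl⟩
    · exact .inr ⟨t, le_rfl, h⟩
  | d, t, half e₁ e₂, h => by
    rcases h with h | h | h | h | h
    · exact writes_toVecProg h
    · rcases writes_toVecProg h with h | ⟨j, hj, rfl⟩
      · exact .inl h
      · exact .inr ⟨j, by omega, rfl⟩
    · exact .inr ⟨t + 2, by omega, h⟩
    · simp only [halfStep, copy, Writes] at h
      rcases h with h | h | h | h | h | h | h | h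
      · exact .inr ⟨t + 3, by omega, h⟩
      · exact .inr ⟨t + 4, by omega, h⟩
      · exact .inr ⟨t + 4, by omega, h⟩
      · exact .inr ⟨t + 2, by omega, h⟩
      · exact .inr ⟨t + 4, by omega, h⟩
      · exact .inr ⟨t, by omega, h⟩
      · exact .inr ⟨t + 4, by omega, h⟩
      · exact .inr ⟨t + 1, by omega, h⟩
    · exact .inr ⟨t, le_rfl, h⟩

/-- Working with all large `N` avoids an explicit count of the registers. -/
theorem eventually_wf_toVecProg : ∀ (d t : ℕ) (e : VecExpr),
    ∀ᶠ N in Filter.atTop, (toVecProg d t e).WF N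
  | d, t, var i => by
    filter_upwards [Filter.eventually_ge_atTop (2 * t + 1 + 2 * i)] with N hN
    simp only [toVecProg, copy, WF]
    omega
  | d, t, op f e₁ e₂ => by
    filter_upwards [Filter.eventually_ge_atTop (2 * t + 3), eventually_wf_toVecProg d t e₁,
      eventually_wf_toVecProg d (t + 1) e₂] with N hN h₁ h₂
    simp only [toVecProg, WF, h₁, h₂, true_and]
    omega
  | d, t, mul e => by
    filter_upwards [Filter.eventually_ge_atTop (2 * t + 3),
      eventually_wf_toVecProg d (t + 1) e] with N hN h
    simp only [toVecProg, WF, h, true_and]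
    omega
  | d, t, any e => by
    filter_upwards [Filter.eventually_ge_atTop (2 * t + 3),
      eventually_wf_toVecProg d t e] with N hN h
    simp only [toVecProg, WF, h, true_and]
    omega
  | d, t, ex e => by
    filter_upwards [Filter.eventually_ge_atTop (2 * t + 2 * d + 3),
      eventually_wf_toVecProg (d + 1) (t + 1) e] with N hN h
    simp only [toVecProg, WF, h, true_and, Writes, not_or]
    refine ⟨by omega, ⟨fun h => ?_, by omega⟩, by omega⟩
    rcases writes_toVecProg h with ⟨i, hi, h⟩ | ⟨i, hi, h⟩ <;> omega
  | d, t, half e₁ e₂ => by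
    filter_upwards [Filter.eventually_ge_atTop (2 * t + 9), eventually_wf_toVecProg d t e₁,
      eventually_wf_toVecProg d (t + 1) e₂] with N hN h₁ h₂
    simp only [toVecProg, halfStep, copy, WF, h₁, h₂, true_and, Writes]
    omega

/-! ### Correctness of the compiled expressions. -/

section Correctness

variable {n : ℕ} (M : Fin n → Fin n → Bool)

/-- Register `2 * t + 1` accumulates the disjunction. The loop variable `2 * d` is exempt from the
invariant, since every pass overwrites it. -/
theorem foldl_ex {d t : ℕ} {p : VecProg} {ρ : ℕ → Fin n → Bool} (x : Fin n → Fin n → Bool)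
    (hp : ∀ st v, (∀ i, st (2 * i) = Function.update ρ d (fun j => decide (j = v)) i) →
      run M p st (2 * t + 1) = st (2 * t + 1) ∧ run M p st (2 * (t + 1) + 1) = x v ∧
        ∀ i, run M p st (2 * i) = st (2 * i)) (l : List (Fin n)) (st : ℕ → Fin n → Bool)
    (hst : ∀ i, i ≠ d → st (2 * i) = ρ i) :
    l.foldl (fun st v => run M (.seq p (.zip or (2 * t + 1) (2 * (t + 1) + 1)))
        (Function.update st (2 * d) fun j => decide (j = v))) st (2 * t + 1) =
      (fun i => st (2 * t + 1) i || l.any fun v => x v i) ∧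
    ∀ i, i ≠ d → l.foldl (fun st v => run M (.seq p (.zip or (2 * t + 1) (2 * (t + 1) + 1)))
        (Function.update st (2 * d) fun j => decide (j = v))) st (2 * i) = ρ i := by
  induction l generalizing st with
  | nil => simpa using hst
  | cons v l ih =>
    have h₀ : ∀ i, Function.update st (2 * d) (fun j => decide (j = v)) (2 * i) =
        Function.update ρ d (fun j => decide (j = v)) i := by
      intro i
      by_cases h : i = d
      · subst h; simp
      · rw [Function.update_of_ne h, Function.update_of_ne (by omega), hst i h]
    obtain ⟨h₁, h₂, h₃⟩ := hp _ v h₀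
    obtain ⟨h₄, h₅⟩ := ih (run M (.seq p (.zip or (2 * t + 1) (2 * (t + 1) + 1)))
      (Function.update st (2 * d) fun j => decide (j = v))) fun i hi => by
        rw [run, run, Function.update_of_ne (by omega), h₃, h₀, Function.update_of_ne hi]
    refine ⟨?_, h₅⟩
    rw [List.foldl_cons, h₄]
    funext i
    rw [run, run, Function.update_self, h₁, h₂, Function.update_of_ne (by omega)]
    simp [Bool.or_assoc]

/-- Each round first records the points in the `k`-ball of `x` but not in that of `y`, then enlarges
both balls. The loop variable is never read; only the number of rounds matters. -/
theorem foldl_half {t : ℕ} (x y : Fin n → Bool) (l : List (Fin n)) (k : ℕ)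
    (st : ℕ → Fin n → Bool) (hx : st (2 * t + 1) = ball M x k)
    (hy : st (2 * (t + 1) + 1) = ball M y k)
    (hz : st (2 * (t + 2) + 1) =
      fun i => (List.range k).any fun k => ball M x k i && !ball M y k i) :
    l.foldl (fun st v => run M (halfStep t)
        (Function.update st (2 * (t + 3) + 1) fun j => decide (j = v))) st (2 * (t + 2) + 1) =
      fun i => (List.range (k + l.length)).any fun k => ball M x k i && !ball M y k i := by
  induction l generalizing st k with
  | nil => simpa using hz
  | cons v l ih =>
    rw [List.foldl_cons, ih (k + 1)]
    · simp only [List.length_cons, Nat.add_assoc, Nat.add_comm 1]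
    · simp [halfStep, copy, run, hx, ball, prod]
    · simp [halfStep, copy, run, hy, ball, prod]
    · simp [halfStep, copy, run, hx, hy, hz, List.range_succ]

/-- Registers of unbound variables are assumed to be zero because a loop resets its variable to
zero; under this assumption all even registers are preserved, which makes the induction go through.
-/
theorem run_toVecProg : ∀ {d : ℕ} (t : ℕ) (e : VecExpr) (st : ℕ → Fin n → Bool),
    (∀ i, d ≤ i → st (2 * i) = fun _ => false) →
    run M (toVecProg d t e) st (2 * t + 1) = eval M d (fun i => st (2 * i)) e ∧
      ∀ i, run M (toVecProg d t e) st (2 * i) = st (2 * i)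
  | d, t, var i, st, _ => by
    refine ⟨Function.update_self .., fun j => Function.update_of_ne (by omega) ..⟩
  | d, t, op f e₁ e₂, st, h => by
    obtain ⟨h₁, h₂⟩ := run_toVecProg t e₁ st h
    obtain ⟨h₃, h₄⟩ := run_toVecProg (d := d) (t + 1) e₂ (run M (toVecProg d t e₁) st)
      fun i hi => (h₂ i).trans (h i hi)
    simp only [h₂] at h₃ h₄
    refine ⟨?_, fun i => ?_⟩
    · rw [toVecProg, run, run, run, Function.update_self, h₃, run_of_not_writes, h₁]
      · rfl
      · intro h
        rcases writes_toVecProg h with ⟨i, hi, h⟩ | ⟨i, hi, h⟩ <;> omega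
    · rw [toVecProg, run, run, run, Function.update_of_ne (by omega), h₄]
  | d, t, mul e, st, h => by
    obtain ⟨h₁, h₂⟩ := run_toVecProg (t + 1) e st h
    refine ⟨?_, fun i => ?_⟩
    · rw [toVecProg, run, run, Function.update_self, h₁]
      rfl
    · rw [toVecProg, run, run, Function.update_of_ne (by omega), h₂]
  | d, t, any e, st, h => by
    obtain ⟨h₁, h₂⟩ := run_toVecProg t e st h
    refine ⟨?_, fun i => ?_⟩
    · rw [toVecProg, run, run, Function.update_self, h₁]
      rfl
    · rw [toVecProg, run, run, Function.update_of_ne (by omega), h₂]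
  | d, t, ex e, st, h => by
    have key := foldl_ex M (d := d) (t := t) (p := toVecProg (d + 1) (t + 1) e)
      (ρ := fun i => st (2 * i))
      (fun v => eval M (d + 1) (Function.update (fun i => st (2 * i)) d fun j => decide (j = v)) e)
      (fun st' v h' => by
        obtain ⟨h₁, h₂⟩ := run_toVecProg (d := d + 1) (t + 1) e st' fun i hi => by
          rw [h' i, Function.update_of_ne (by omega), h i (by omega)]
        refine ⟨run_of_not_writes M (fun h => ?_) _, ?_, h₂⟩
        · rcases writes_toVecProg h with ⟨i, hi, h⟩ | ⟨i, hi, h⟩ <;> omega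
        · rw [h₁]
          congr 1
          exact funext h')
      (List.finRange n) (Function.update st (2 * t + 1) fun _ => false)
      fun i hi => Function.update_of_ne (by omega) _ _
    refine ⟨?_, fun i => ?_⟩
    · rw [toVecProg, run, run, run, Function.update_of_ne (by omega), key.1]
      simp [eval]
    · rw [toVecProg, run, run, run]
      by_cases hi : i = d
      · subst hi
        rw [Function.update_self, h i le_rfl]
      · rw [Function.update_of_ne (by omega), key.2 i hi]
  | d, t, half e₁ e₂, st, h => by
    obtain ⟨h₁, h₂⟩ := run_toVecProg t e₁ st h
    obtain ⟨h₃, h₄⟩ := run_toVecProg (d := d) (t + 1) e₂ (run M (toVecProg d t e₁) st)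
      fun i hi => (h₂ i).trans (h i hi)
    simp only [h₂] at h₃ h₄
    have h₅ : run M (toVecProg d (t + 1) e₂) (run M (toVecProg d t e₁) st) (2 * t + 1) =
        eval M d (fun i => st (2 * i)) e₁ := by
      rw [run_of_not_writes, h₁]
      intro h
      rcases writes_toVecProg h with ⟨i, hi, h⟩ | ⟨i, hi, h⟩ <;> omega
    refine ⟨?_, fun i => ?_⟩
    · simp only [toVecProg, run, copy, Function.update_self]
      rw [Function.update_of_ne (by omega), foldl_half M (eval M d (fun i => st (2 * i)) e₁)
        (eval M d (fun i => st (2 * i)) e₂) _ 0]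
      · simp [eval]
      · rw [Function.update_of_ne (by omega), h₅]
        rfl
      · rw [Function.update_of_ne (by omega), h₃]
        rfl
      · simp
    · rw [toVecProg, run, run, run, run, run_of_not_writes,
        Function.update_of_ne (by omega), h₄]
      · simp only [Writes, halfStep, copy]
        omega

end Correctness

/-! ### Logical connectives and the decidability criterion. -/

section Logic

/-- The constant expression. -/
def const (b : Bool) : VecExpr := op (fun _ _ => b) (var 0) (var 0)

/-- The negation of an expression. -/
def neg (e : VecExpr) : VecExpr := op (fun a _ => !a) e e

/-- The conjunction of a list of expressions. -/
def conj (l : List VecExpr) : VecExpr := l.foldr (op and) (const true)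

/-- The disjunction of a list of expressions. -/
def disj (l : List VecExpr) : VecExpr := l.foldr (op or) (const false)

/-- Bind `k` variables. -/
def exs : ℕ → VecExpr → VecExpr
  | 0, e => e
  | k + 1, e => ex (exs k e)

variable {n : ℕ} (M : Fin n → Fin n → Bool) (d : ℕ) (ρ : ℕ → Fin n → Bool) {i : Fin n}

@[simp] theorem eval_var (j : ℕ) : eval M d ρ (var j) = ρ j := rfl

@[simp] theorem eval_mul (e : VecExpr) : eval M d ρ (mul e) = prod M (eval M d ρ e) := rfl

@[simp] theorem eval_const (b : Bool) : eval M d ρ (const b) i = b := rfl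

@[simp] theorem eval_neg (e : VecExpr) : eval M d ρ (neg e) i = !eval M d ρ e i := rfl

@[simp] theorem eval_and (e e' : VecExpr) :
    eval M d ρ (op and e e') i = (eval M d ρ e i && eval M d ρ e' i) := rfl

@[simp] theorem eval_or (e e' : VecExpr) :
    eval M d ρ (op or e e') i = (eval M d ρ e i || eval M d ρ e' i) := rfl

@[simp] theorem eval_conj (l : List VecExpr) :
    eval M d ρ (conj l) i = true ↔ ∀ e ∈ l, eval M d ρ e i = true := by
  induction l with
  | nil => simp [conj]
  | cons e l ih => simpa [conj] using fun _ => ih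

@[simp] theorem eval_disj (l : List VecExpr) :
    eval M d ρ (disj l) i = true ↔ ∃ e ∈ l, eval M d ρ e i = true := by
  induction l with
  | nil => simp [disj]
  | cons e l ih =>
    simp only [disj, List.foldr_cons, eval_or, Bool.or_eq_true, List.mem_cons,
      exists_eq_or_imp] at ih ⊢
    rw [ih]

@[simp] theorem eval_any (e : VecExpr) :
    eval M d ρ (any e) i = true ↔ ∃ j, eval M d ρ e j = true := by
  simp [eval]

@[simp] theorem eval_ex (e : VecExpr) : eval M d ρ (ex e) i = true ↔
    ∃ v, eval M (d + 1) (Function.update ρ d fun j => decide (j = v)) e i = true := by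
  simp [eval]

theorem eval_exs (k : ℕ) (e : VecExpr) : eval M d ρ (exs k e) i = true ↔
    ∃ w : ℕ → Fin n, eval M (d + k)
      (fun j => if d ≤ j ∧ j < d + k then fun x => decide (x = w j) else ρ j) e i = true := by
  induction k generalizing d ρ with
  | zero =>
    have h : ∀ j, ¬ (d ≤ j ∧ j < d) := by omega
    simp only [exs, h, if_false, Nat.add_zero]
    -- No variable is bound; `i` merely provides some value for the function `w`.
    exact ⟨fun h => ⟨fun _ => i, h⟩, fun ⟨_, h⟩ => h⟩
  | succ k ih =>
    simp only [exs, eval_ex, ih]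
    constructor
    · rintro ⟨v, w, h⟩
      refine ⟨Function.update w d v, ?_⟩
      convert h using 2
      · ring
      · funext j
        rcases lt_trichotomy j d with hj | rfl | hj
        · rw [if_neg (by omega), if_neg (by omega), Function.update_of_ne (by omega)]
        · rw [if_pos ⟨le_rfl, by omega⟩, if_neg fun h => by omega, Function.update_self,
            Function.update_self]
        · simp only [Function.update_of_ne hj.ne']
          congr 1
          simp
          omega
    · rintro ⟨w, h⟩
      refine ⟨w d, w, ?_⟩
      convert h using 2
      · ring
      · funext j
        rcases lt_trichotomy j d with hj | rfl | hj
        · rw [if_neg (by omega), if_neg (by omega), Function.update_of_ne (by omega)]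
        · rw [if_neg fun h => by omega, if_pos ⟨le_rfl, by omega⟩, Function.update_self]
        · simp only [Function.update_of_ne hj.ne']
          congr 1
          simp
          omega

/-- If closed expressions describe a property of words, which are given by matrices, then this
property is decidable in polynomial time. -/
theorem decidableInPolyTime {α : Type} {encode : α → List (Option Bool)} {P : α → Prop}
    {n : α → ℕ} {M : ∀ a, Fin (n a) → Fin (n a) → Bool} (e : VecExpr)
    (henc : ∀ a, encode a = StackProg.rows (List.finRange (n a)) (List.finRange (n a)) (M a))
    (hP : ∀ a, P a ↔ ∃ i, e.eval (M a) 0 (fun _ _ => false) i = true) :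
    PartialCubes.DecidableInPolyTime encode P := by
  obtain ⟨N, hN, hN'⟩ :=
    ((eventually_wf_toVecProg 0 0 e).and (Filter.eventually_ge_atTop 1)).exists
  refine StackProg.decidableInPolyTime_of_vecProg (N := N)
    -- The value of `e` is left in register 1, whereas the machine reads its answer from register 0.
    (p := .seq (toVecProg 0 0 e) (copy 0 1)) ⟨hN, by simp, by simp, hN'⟩ henc fun a => ?_
  rw [hP, run, copy, run, Function.update_self,
    (run_toVecProg (M a) 0 e (fun _ _ => false) fun _ _ => rfl).1]

end Logic

end VecExpr

/-! ### Partial cubes as sets of sign vectors. -/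

namespace PartialCubes

section CubeRep

variable {V W ι κ : Type}

/-- The graph `H` is isomorphic through `g` to an isometric subgraph of a hypercube. -/
structure IsCubeRep (H : SimpleGraph W) (g : W → ι → Bool) : Prop where
  injective : Function.Injective g
  adj_iff : ∀ {x y}, H.Adj x y ↔ ∃! i, g x i ≠ g y i
  exists_agree : ∀ {x y}, x ≠ y →
    ∃ z i, g x i ≠ g y i ∧ g z i = g y i ∧ ∀ j, j ≠ i → g z j = g x j

theorem hammingDist_lt [Fintype ι] {a b c : ι → Bool} {i : ι} (hab : a i ≠ b i)
    (hc : c i = b i) (h : ∀ j, j ≠ i → c j = a j) : hammingDist c b < hammingDist a b := by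
  refine Finset.card_lt_card ⟨fun j hj => ?_, fun h' => ?_⟩
  · simp only [Finset.mem_filter_univ] at hj ⊢
    by_cases hji : j = i
    · subst hji
      exact hab
    · rwa [h j hji] at hj
  · have := @h' i (by simpa using hab)
    simp [hc] at this

theorem hammingDist_eq_one_iff [Fintype ι] {a b : ι → Bool} :
    hammingDist a b = 1 ↔ ∃! i, a i ≠ b i := by
  rw [hammingDist, Finset.card_eq_one]
  simp only [Finset.ext_iff, Finset.mem_filter_univ, Finset.mem_singleton, ExistsUnique]
  refine exists_congr fun i => ⟨fun h => ⟨(h i).2 rfl, fun j => (h j).1⟩, fun h j => ⟨h.2 j, ?_⟩⟩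
  rintro rfl
  exact h.1

namespace IsCubeRep

variable {H : SimpleGraph W} {g : W → ι → Bool}

theorem adj_of_ne (hg : IsCubeRep H g) {x y : W} {i : ι} (h : g x i ≠ g y i)
    (h' : ∀ j, j ≠ i → g y j = g x j) : H.Adj x y :=
  hg.adj_iff.2 ⟨i, h, fun j hj => by
    by_contra hji
    exact hj (h' j hji).symm⟩

theorem agree (hg : IsCubeRep H g) {x y : W} (h : H.Adj x y) {i j : ι} (hi : g x i ≠ g y i)
    (hj : j ≠ i) : g x j = g y j := by
  by_contra h'
  exact hj ((hg.adj_iff.1 h).unique h' hi)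

/-- The condition `exists_agree` is a local form of isometry: from `x` one can always flip a
coordinate in which it differs from `y`. Repeating this gives a walk of Hamming length, and no walk
is shorter because an edge flips only one coordinate. -/
theorem edist_eq [Fintype ι] (hg : IsCubeRep H g) (x y : W) :
    H.edist x y = hammingDist (g x) (g y) := by
  refine le_antisymm ?_ ?_
  · induction hk : hammingDist (g x) (g y) using Nat.strong_induction_on generalizing x with
    | _ k ih =>
      by_cases hxy : x = y
      · simp [hxy]
      · obtain ⟨z, i, h₁, h₂, h₃⟩ := hg.exists_agree hxy
        have hlt := hammingDist_lt h₁ h₂ h₃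
        have hadj : H.Adj x z := hg.adj_of_ne (by rwa [h₂]) h₃
        calc H.edist x y ≤ H.edist x z + H.edist z y := SimpleGraph.edist_triangle
          _ ≤ 1 + hammingDist (g z) (g y) := by
            rw [SimpleGraph.edist_eq_one_iff_adj.2 hadj]
            exact add_le_add le_rfl (ih _ (hk ▸ hlt) z rfl)
          _ ≤ k := by
            rw [← hk]
            exact_mod_cast (by omega : 1 + hammingDist (g z) (g y) ≤ hammingDist (g x) (g y))
  · refine le_iInf fun p => ?_
    norm_cast
    induction p with
    | nil => simp
    | @cons a b c h p ih =>
      refine (hammingDist_triangle _ (g b) _).trans ?_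
      rw [hammingDist_eq_one_iff.2 (hg.adj_iff.1 h), SimpleGraph.Walk.length_cons]
      omega

/-- As `u` and `v` differ only in coordinate `i`, that coordinate alone decides which of them is
closer in Hamming distance. -/
theorem mem_halfspace [Fintype ι] (hg : IsCubeRep H g) {u v x : W} {i : ι} (h : H.Adj u v)
    (hi : g u i ≠ g v i) : x ∈ halfspace H u v ↔ g x i = g u i := by
  rw [halfspace, Set.mem_ofPred_eq, hg.edist_eq, hg.edist_eq, Nat.cast_lt]
  have key : ∀ {u v}, H.Adj u v → g u i ≠ g v i → g x i = g u i →
      hammingDist (g x) (g u) < hammingDist (g x) (g v) := by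
    intro u v h hi hx
    rw [hammingDist_comm, hammingDist_comm (g x)]
    exact hammingDist_lt (i := i) (by rw [hx]; exact hi.symm) hx.symm
      fun j hj => hg.agree h hi hj
  refine ⟨fun h' => ?_, key h hi⟩
  by_contra hx
  have hx' : g x i = g v i := by
    revert hx hi
    cases g x i <;> cases g u i <;> cases g v i <;> simp
  have := key h.symm hi.symm hx'
  omega

/-- On a geodesic from `x` to `y`, some edge flips `i`. -/
theorem exists_adj [Fintype ι] (hg : IsCubeRep H g) {x y : W} {i : ι} (h : g x i ≠ g y i) :
    ∃ u v, H.Adj u v ∧ g u i = g x i ∧ g v i = g y i := by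
  induction hk : hammingDist (g x) (g y) using Nat.strong_induction_on generalizing x with
  | _ k ih =>
    obtain ⟨z, j, h₁, h₂, h₃⟩ := hg.exists_agree (x := x) (y := y) (by rintro rfl; exact h rfl)
    by_cases hij : i = j
    · subst hij
      exact ⟨x, z, hg.adj_of_ne (by rwa [h₂]) h₃, rfl, h₂⟩
    · rw [← h₃ i hij] at h ⊢
      exact ih _ (hk ▸ hammingDist_lt h₁ h₂ h₃) h rfl

/-- A step toward `y` flips a coordinate where `x` and `y` differ, hence never `i`, and so stays in
the halfspace. -/
theorem induce_halfspace [Fintype ι] (hg : IsCubeRep H g) {u v : W} {i : ι} (h : H.Adj u v)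
    (hi : g u i ≠ g v i) : IsCubeRep (H.induce (halfspace H u v)) fun x => g x where
  injective := hg.injective.comp Subtype.val_injective
  adj_iff := hg.adj_iff
  exists_agree {x y} hxy := by
    obtain ⟨z, j, h₁, h₂, h₃⟩ := hg.exists_agree (Subtype.val_injective.ne hxy)
    have hx := (hg.mem_halfspace h hi).1 x.2
    have hy := (hg.mem_halfspace h hi).1 y.2
    have hij : i ≠ j := by
      rintro rfl
      exact h₁ (hx.trans hy.symm)
    exact ⟨⟨z, (hg.mem_halfspace h hi).2 ((h₃ i hij).trans hx)⟩, j, h₁, h₂, h₃⟩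

end IsCubeRep

/-! ### Contraction as the deletion of a coordinate. -/

/-- Replace the coordinates in `K` by `false`. -/
def clear [DecidableEq ι] (K : Finset ι) (a : ι → Bool) (i : ι) : Bool :=
  if i ∈ K then false else a i

theorem clear_of_mem [DecidableEq ι] {K : Finset ι} {a : ι → Bool} {i : ι} (h : i ∈ K) :
    clear K a i = false := if_pos h

theorem clear_of_notMem [DecidableEq ι] {K : Finset ι} {a : ι → Bool} {i : ι} (h : i ∉ K) :
    clear K a i = a i := if_neg h

theorem clear_clear [DecidableEq ι] {K K' : Finset ι} {a : ι → Bool} :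
    clear K (clear K' a) = clear (K ∪ K') a := by
  funext i
  by_cases h : i ∈ K <;> by_cases h' : i ∈ K' <;> simp [clear, h, h']

namespace IsCubeRep

variable {H : SimpleGraph W} {g : W → ι → Bool} [Fintype ι] [DecidableEq ι]

omit [DecidableEq ι] in
theorem mem_thetaClass (hg : IsCubeRep H g) {u v x y : W} {i : ι} (h : H.Adj u v)
    (hi : g u i ≠ g v i) : s(x, y) ∈ thetaClass H u v ↔ H.Adj x y ∧ g x i ≠ g y i := by
  constructor
  · rintro ⟨x', y', he, hadj, hx, hy⟩
    rw [hg.mem_halfspace h hi] at hx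
    rw [hg.mem_halfspace h.symm hi.symm] at hy
    rcases Sym2.eq_iff.1 he with ⟨rfl, rfl⟩ | ⟨rfl, rfl⟩
    · exact ⟨hadj, by rwa [hx, hy]⟩
    · exact ⟨hadj.symm, by rw [hx, hy]; exact hi.symm⟩
  · rintro ⟨hadj, hxy⟩
    by_cases hx : g x i = g u i
    · refine ⟨x, y, rfl, hadj, (hg.mem_halfspace h hi).2 hx,
        (hg.mem_halfspace h.symm hi.symm).2 ?_⟩
      revert hx hi hxy
      cases g x i <;> cases g u i <;> cases g v i <;> cases g y i <;> simp
    · refine ⟨y, x, Sym2.eq_swap, hadj.symm, (hg.mem_halfspace h hi).2 ?_,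
        (hg.mem_halfspace h.symm hi.symm).2 ?_⟩ <;>
      · revert hx hi hxy
        cases g x i <;> cases g u i <;> cases g v i <;> cases g y i <;> simp

theorem connectedComponentMk_eq_iff (hg : IsCubeRep H g) {u v x y : W} {i : ι} (h : H.Adj u v)
    (hi : g u i ≠ g v i) :
    (SimpleGraph.fromEdgeSet (thetaClass H u v)).connectedComponentMk x =
      (SimpleGraph.fromEdgeSet (thetaClass H u v)).connectedComponentMk y ↔
      clear {i} (g x) = clear {i} (g y) := by
  rw [SimpleGraph.ConnectedComponent.eq]
  constructor
  · rintro ⟨p⟩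
    induction p with
    | nil => rfl
    | cons hadj p ih =>
      rw [← ih]
      obtain ⟨hadj, hne⟩ := (hg.mem_thetaClass h hi).1 hadj.1
      funext j
      by_cases hj : j = i
      · simp [clear, hj]
      · simp [clear, hj, hg.agree hadj hne hj]
  · intro hxy
    have hxy' : ∀ j, j ≠ i → g y j = g x j := fun j hj => by
      simpa [clear, hj] using (congrFun hxy j).symm
    by_cases hi' : g x i = g y i
    · have : x = y := hg.injective (funext fun j => by
        by_cases hj : j = i
        · rwa [hj]
        · exact (hxy' j hj).symm)
      rw [this]
    · have hadj := hg.adj_of_ne hi' hxy'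
      exact (SimpleGraph.Adj.reachable
        ⟨(hg.mem_thetaClass h hi).2 ⟨hadj, hi'⟩, hadj.ne⟩)

/-- The components to be contracted are the fibres of the map that clears `i`, so this map descends
to the quotient. The work lies in lifting edges and geodesic steps from the quotient. -/
theorem contractEdges_thetaClass (hg : IsCubeRep H g) {u v : W} {i : ι} (h : H.Adj u v)
    (hi : g u i ≠ g v i) : ∃ g', IsCubeRep (contractEdges H (thetaClass H u v)) g' ∧
      ∀ x, g' ((SimpleGraph.fromEdgeSet (thetaClass H u v)).connectedComponentMk x) =
        clear {i} (g x) := by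
  set mk := (SimpleGraph.fromEdgeSet (thetaClass H u v)).connectedComponentMk with hmk
  have hmk_iff : ∀ {x y}, mk x = mk y ↔ clear {i} (g x) = clear {i} (g y) :=
    hg.connectedComponentMk_eq_iff h hi
  have hsurj : ∀ a, ∃ x, mk x = a := fun a => a.exists_rep
  choose r hr using hsurj
  have hr' : ∀ x, clear {i} (g (r (mk x))) = clear {i} (g x) := fun x => hmk_iff.1 (hr _)
  have hne : ∀ {j : ι} {x y : W}, clear {i} (g x) j ≠ clear {i} (g y) j ↔
      j ≠ i ∧ g x j ≠ g y j := by
    intro j x y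
    by_cases hj : j = i <;> simp [clear, hj]
  refine ⟨fun a => clear {i} (g (r a)),
    ⟨fun a b hab => ?_, fun {a b} => ?_, fun {a b} hab => ?_⟩, hr'⟩
  · rw [← hr a, ← hr b]
    exact hmk_iff.2 hab
  · obtain ⟨x, rfl⟩ : ∃ x, mk x = a := ⟨_, hr a⟩
    obtain ⟨y, rfl⟩ : ∃ y, mk y = b := ⟨_, hr b⟩
    simp only [hr']
    rw [contractEdges, SimpleGraph.map_adj']
    constructor
    · rintro ⟨hxy, x', y', hadj, hx, hy⟩
      change mk x' = mk x at hx
      change mk y' = mk y at hy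
      rw [← hx, ← hy, Ne, hmk_iff] at hxy
      rw [hmk_iff] at hx hy
      rw [← hx, ← hy]
      obtain ⟨j, hj⟩ := Function.ne_iff.1 hxy
      exact ⟨j, hj, fun k hk => (hg.adj_iff.1 hadj).unique (hne.1 hk).2 (hne.1 hj).2⟩
    · rintro ⟨j, hj, huniq⟩
      have hxy : ¬ mk x = mk y := fun hxy => hj (congrFun (hmk_iff.1 hxy) j)
      refine ⟨hxy, ?_⟩
      obtain ⟨hji, hj⟩ := hne.1 hj
      have hagree : ∀ k, k ≠ i → k ≠ j → g y k = g x k := by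
        intro k hki hkj
        by_contra h'
        exact hkj (huniq k (hne.2 ⟨hki, Ne.symm h'⟩))
      obtain ⟨z, k, h₁, h₂, h₃⟩ := hg.exists_agree (x := x) (y := y) (by rintro rfl; exact hj rfl)
      -- The cleared vectors of `x` and `y` differ only in `j`. If the step toward `y` flips `i`,
      -- then `z` lies over `mk x` and is adjacent to `y`; otherwise it flips `j`, and `z` lies over
      -- `mk y` and is adjacent to `x`.
      by_cases hki : k = i
      · subst hki
        refine ⟨z, y, hg.adj_of_ne (i := j) (by rwa [h₃ j hji]) fun l hl => ?_, ?_, rfl⟩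
        · by_cases hlk : l = k
          · rw [hlk, h₂]
          · rw [h₃ l hlk, hagree l hlk hl]
        · refine hmk_iff.2 (funext fun l => ?_)
          by_cases hlk : l = k
          · simp [clear, hlk]
          · simp [clear, hlk, h₃ l hlk]
      · obtain rfl : k = j := by
          by_contra hkj
          exact h₁ (hagree k hki hkj).symm
        refine ⟨x, z, hg.adj_of_ne (i := k) (by rwa [h₂]) h₃, rfl, ?_⟩
        refine hmk_iff.2 (funext fun l => ?_)
        by_cases hli : l = i
        · simp [clear, hli]
        · by_cases hlk : l = k
          · simp [clear, hlk, h₂]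
          · simp [clear, hli, h₃ l hlk, hagree l hli hlk]
  · obtain ⟨x, rfl⟩ : ∃ x, mk x = a := ⟨_, hr a⟩
    obtain ⟨y, rfl⟩ : ∃ y, mk y = b := ⟨_, hr b⟩
    have key : ∀ x, mk x ≠ mk y → g x i = g y i → ∃ z j, j ≠ i ∧ g x j ≠ g y j ∧ g z j = g y j ∧
        ∀ k, k ≠ j → g z k = g x k := by
      intro x hxy hi'
      obtain ⟨z, j, h₁, h₂, h₃⟩ := hg.exists_agree (x := x) (y := y) (by rintro rfl; exact hxy rfl)
      exact ⟨z, j, by rintro rfl; exact h₁ hi', h₁, h₂, h₃⟩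
    obtain ⟨z, j, hj, h₁, h₂, h₃⟩ : ∃ z j, j ≠ i ∧ g x j ≠ g y j ∧ g z j = g y j ∧
        ∀ k, k ≠ i → k ≠ j → g z k = g x k := by
      obtain ⟨z, j, h₁, h₂, h₃⟩ := hg.exists_agree (x := x) (y := y) (by rintro rfl; exact hab rfl)
      -- A step that flips `i` is invisible in the quotient. After it `i` agrees with `y`, so the
      -- next step flips another coordinate.
      by_cases hj : j = i
      · subst hj
        have hzx : mk z = mk x := hmk_iff.2 (funext fun l => by
          by_cases hl : l = j
          · simp [clear, hl]
          · simp [clear, hl, h₃ l hl])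
        obtain ⟨z', k, hk, h₄, h₅, h₆⟩ := key z (by rwa [hzx]) h₂
        refine ⟨z', k, hk, by rwa [h₃ k hk] at h₄, h₅, fun l hl hl' => ?_⟩
        rw [h₆ l hl', h₃ l hl]
      · exact ⟨z, j, hj, h₁, h₂, fun k _ hk => h₃ k hk⟩
    refine ⟨mk z, j, ?_, ?_, fun k hk => ?_⟩
    · simp only [hr']
      exact hne.2 ⟨hj, h₁⟩
    · simp only [hr']
      simp [clear, hj, h₂]
    · simp only [hr']
      by_cases hki : k = i
      · simp [clear, hki]
      · simp [clear, hki, h₃ k hki hk]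

end IsCubeRep

/-! ### Minors in coordinates. -/

section Minors

variable [Fintype ι] [DecidableEq ι] {G : SimpleGraph V} {f : V → ι → Bool}

/-- The subset of the hypercube that represents the minor obtained by a restriction to the vertices
that agree with `s` on `I`, and a contraction of the classes in `K`. -/
def minorRange (f : V → ι → Bool) (I : Finset ι) (s : ι → Bool) (K : Finset ι) :
    Set (ι → Bool) :=
  {a | ∃ x, (∀ i ∈ I, f x i = s i) ∧ a = clear K (f x)}

omit [Fintype ι] in
theorem range_eq_minorRange (s : ι → Bool) : Set.range f = minorRange f ∅ s ∅ :=
  Set.ext fun a => ⟨fun ⟨x, hx⟩ => ⟨x, by simp, hx.symm⟩, fun ⟨x, _, hx⟩ => ⟨x, hx.symm⟩⟩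

/-- An edge of a minor flips a coordinate outside `K`. Restriction adds this coordinate to `I`,
contraction adds it to `K`, and the order of the operations becomes irrelevant. -/
theorem IsPCMinor.exists_rep (hG : IsCubeRep G f) {H : SimpleGraph W} (h : IsPCMinor G H) :
    ∃ g I s K, IsCubeRep H g ∧ Set.range g = minorRange f I s K := by
  induction h with
  | self =>
    exact ⟨f, ∅, fun _ => false, ∅, hG, range_eq_minorRange _⟩
  | @iso W W' H H' _ e ih =>
    obtain ⟨g, I, s, K, hg, hr⟩ := ih
    refine ⟨fun x => g (e.symm x), I, s, K, ⟨hg.injective.comp e.symm.injective, ?_, ?_⟩, ?_⟩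
    · intro x y
      rw [← hg.adj_iff, e.symm.map_adj_iff]
    · intro x y hxy
      obtain ⟨z, i, h₁, h₂, h₃⟩ := hg.exists_agree (e.symm.injective.ne hxy)
      exact ⟨e z, i, h₁, by simpa using h₂, by simpa using h₃⟩
    · rw [← hr]
      exact e.symm.surjective.range_comp g
  | @restriction W H u v _ hadj ih =>
    obtain ⟨g, I, s, K, hg, hr⟩ := ih
    obtain ⟨i, hi, -⟩ := hg.adj_iff.1 hadj
    have hr' := fun a => Set.ext_iff.1 hr a
    have hu : g u ∈ minorRange f I s K := (hr' _).1 ⟨u, rfl⟩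
    have hv : g v ∈ minorRange f I s K := (hr' _).1 ⟨v, rfl⟩
    have hiK : i ∉ K := by
      intro hiK
      obtain ⟨x, -, hx⟩ := hu
      obtain ⟨y, -, hy⟩ := hv
      rw [hx, hy, clear_of_mem hiK, clear_of_mem hiK] at hi
      exact hi rfl
    obtain ⟨x₀, hx₀, hu⟩ := hu
    -- A preimage `x₀` of `u` has the old signs on `I` and the sign of `u` at `i`, so it serves as
    -- the new sign vector.
    refine ⟨_, insert i I, f x₀, K, hg.induce_halfspace hadj hi, ?_⟩
    ext a
    constructor
    · rintro ⟨⟨w, hw⟩, rfl⟩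
      rw [hg.mem_halfspace hadj hi] at hw
      obtain ⟨x, hx, hwx⟩ := (hr' _).1 ⟨w, rfl⟩
      refine ⟨x, fun j hj => ?_, hwx⟩
      rcases Finset.mem_insert.1 hj with rfl | hj
      · rwa [hwx, hu, clear_of_notMem hiK, clear_of_notMem hiK] at hw
      · rw [hx j hj, hx₀ j hj]
    · rintro ⟨x, hx, rfl⟩
      obtain ⟨w, hw⟩ := (hr' (clear K (f x))).2 ⟨x, fun j hj => by
        rw [hx j (Finset.mem_insert_of_mem hj), hx₀ j hj], rfl⟩
      refine ⟨⟨w, (hg.mem_halfspace hadj hi).2 ?_⟩, hw⟩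
      rw [hw, hu, clear_of_notMem hiK, clear_of_notMem hiK, hx i (Finset.mem_insert_self _ _)]
  | @contraction W H u v _ hadj ih =>
    obtain ⟨g, I, s, K, hg, hr⟩ := ih
    obtain ⟨i, hi, -⟩ := hg.adj_iff.1 hadj
    obtain ⟨g', hg', hgg⟩ := hg.contractEdges_thetaClass hadj hi
    have hr' := fun a => Set.ext_iff.1 hr a
    refine ⟨g', I, s, {i} ∪ K, hg', ?_⟩
    ext a
    constructor
    · rintro ⟨w, rfl⟩
      induction w using SimpleGraph.ConnectedComponent.ind with | _ w => ?_
      obtain ⟨x, hx, hwx⟩ := (hr' _).1 ⟨w, rfl⟩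
      exact ⟨x, hx, by rw [hgg, hwx, clear_clear]⟩
    · rintro ⟨x, hx, rfl⟩
      obtain ⟨w, hw⟩ := (hr' (clear K (f x))).2 ⟨x, hx, rfl⟩
      exact ⟨_, (hgg w).trans (by rw [hw, clear_clear])⟩

theorem IsCubeRep.exists_restriction (hG : IsCubeRep G f) (s : ι → Bool) (I : Finset ι)
    (hI : ∃ x, ∀ i ∈ I, f x i = s i) : ∃ (W : Type) (H : SimpleGraph W) (g : W → ι → Bool),
      IsPCMinor G H ∧ IsCubeRep H g ∧ Set.range g = minorRange f I s ∅ := by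
  induction I using Finset.induction_on with
  | empty =>
    exact ⟨V, G, f, .self, hG, range_eq_minorRange _⟩
  | insert i I _ ih =>
    obtain ⟨x₀, hx₀⟩ := hI
    obtain ⟨W, H, g, hm, hg, hr⟩ := ih ⟨x₀, fun j hj => hx₀ j (Finset.mem_insert_of_mem hj)⟩
    have hr' := fun a => Set.ext_iff.1 hr a
    have hclear : ∀ x, clear ∅ (f x) = f x := fun x => rfl
    obtain ⟨w₀, hw₀⟩ := (hr' (f x₀)).2 ⟨x₀, fun j hj => hx₀ j (Finset.mem_insert_of_mem hj), rfl⟩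
    have hs : g w₀ i = s i := by rw [hw₀, hx₀ i (Finset.mem_insert_self _ _)]
    -- If `i` is constant on the current minor, no Θ-class belongs to it; its value is already `s
    -- i`, as witnessed by `w₀`, so nothing has to be done.
    by_cases h : ∃ w, g w₀ i ≠ g w i
    · obtain ⟨w, hw⟩ := h
      obtain ⟨u, v, hadj, hu, hv⟩ := hg.exists_adj hw
      have hi : g u i ≠ g v i := by rwa [hu, hv]
      refine ⟨_, _, _, hm.restriction hadj, hg.induce_halfspace hadj hi, ?_⟩
      ext a
      constructor
      · rintro ⟨⟨w, hw⟩, rfl⟩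
        rw [hg.mem_halfspace hadj hi, hu, hs] at hw
        obtain ⟨x, hx, hwx⟩ := (hr' _).1 ⟨w, rfl⟩
        refine ⟨x, fun j hj => ?_, hwx⟩
        rcases Finset.mem_insert.1 hj with rfl | hj
        · rwa [hwx, hclear] at hw
        · exact hx j hj
      · rintro ⟨x, hx, rfl⟩
        obtain ⟨w, hw⟩ := (hr' (f x)).2 ⟨x, fun j hj => hx j (Finset.mem_insert_of_mem hj), rfl⟩
        refine ⟨⟨w, (hg.mem_halfspace hadj hi).2 ?_⟩, hw⟩
        rw [hw, hx i (Finset.mem_insert_self _ _), hu, hs]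
    · push Not at h
      refine ⟨W, H, g, hm, hg, ?_⟩
      ext a
      rw [hr']
      constructor
      · rintro ⟨x, hx, rfl⟩
        refine ⟨x, fun j hj => ?_, rfl⟩
        rcases Finset.mem_insert.1 hj with rfl | hj
        · obtain ⟨w, hw⟩ := (hr' (f x)).2 ⟨x, hx, rfl⟩
          rw [← hw, ← h, hs]
        · exact hx j hj
      · rintro ⟨x, hx, rfl⟩
        exact ⟨x, fun j hj => hx j (Finset.mem_insert_of_mem hj), rfl⟩

theorem IsCubeRep.exists_isPCMinor (hG : IsCubeRep G f) (I : Finset ι) (s : ι → Bool)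
    (K : Finset ι) (hI : ∃ x, ∀ i ∈ I, f x i = s i) :
    ∃ (W : Type) (H : SimpleGraph W) (g : W → ι → Bool),
      IsPCMinor G H ∧ IsCubeRep H g ∧ Set.range g = minorRange f I s K := by
  induction K using Finset.induction_on with
  | empty => exact hG.exists_restriction s I hI
  | insert i K _ ih =>
    obtain ⟨W, H, g, hm, hg, hr⟩ := ih
    have hr' := fun a => Set.ext_iff.1 hr a
    rw [Finset.insert_eq]
    by_cases h : ∃ w w', g w i ≠ g w' i
    · obtain ⟨w, w', hw⟩ := h
      obtain ⟨u, v, hadj, hu, hv⟩ := hg.exists_adj hw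
      have hi : g u i ≠ g v i := by rwa [hu, hv]
      obtain ⟨g', hg', hgg⟩ := hg.contractEdges_thetaClass hadj hi
      refine ⟨_, _, g', hm.contraction hadj, hg', ?_⟩
      ext a
      constructor
      · rintro ⟨w, rfl⟩
        induction w using SimpleGraph.ConnectedComponent.ind with | _ w => ?_
        obtain ⟨x, hx, hwx⟩ := (hr' _).1 ⟨w, rfl⟩
        exact ⟨x, hx, by rw [hgg, hwx, clear_clear]⟩
      · rintro ⟨x, hx, rfl⟩
        obtain ⟨w, hw⟩ := (hr' (clear K (f x))).2 ⟨x, hx, rfl⟩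
        exact ⟨_, (hgg w).trans (by rw [hw, clear_clear])⟩
    -- A constant coordinate can be cleared without an operation: no difference between vectors is
    -- lost.
    · push Not at h
      have hne : ∀ {w w' j}, clear {i} (g w) j ≠ clear {i} (g w') j ↔ g w j ≠ g w' j := by
        intro w w' j
        by_cases hj : j = i
        · subst hj
          simp [clear, h w w']
        · simp [clear, hj]
      refine ⟨W, H, fun w => clear {i} (g w), hm, ⟨fun w w' hw => ?_, ?_, ?_⟩, ?_⟩
      · refine hg.injective (funext fun j => ?_)
        by_contra hj
        exact hne.2 hj (congrFun hw j)
      · intro w w'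
        simp only [hne]
        exact hg.adj_iff
      · intro w w' hww
        obtain ⟨z, j, h₁, h₂, h₃⟩ := hg.exists_agree hww
        refine ⟨z, j, hne.2 h₁, not_ne_iff.1 (hne.not.2 (not_ne_iff.2 h₂)), fun k hk =>
          not_ne_iff.1 (hne.not.2 (not_ne_iff.2 (h₃ k hk)))⟩
      · ext a
        constructor
        · rintro ⟨w, rfl⟩
          obtain ⟨x, hx, hwx⟩ := (hr' _).1 ⟨w, rfl⟩
          exact ⟨x, hx, by simp only [hwx, clear_clear]⟩
        · rintro ⟨x, hx, rfl⟩
          obtain ⟨w, hw⟩ := (hr' (clear K (f x))).2 ⟨x, hx, rfl⟩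
          exact ⟨w, by simp only [hw, clear_clear]⟩

end Minors

/-! ### Minors and models. -/

section Model

/-- One of the two halfspaces of an edge. -/
def side (G : SimpleGraph V) (u v : V) (b : Bool) : Set V :=
  if b then halfspace G u v else halfspace G v u

/-- A certificate for a minor with the given coordinates: vertices `φ w` of `G`, and edges
`a c`, `b c` of `G` for the coordinates `c`, such that on the convex hull of the vertices `φ w` the
edges induce no other vectors than the given ones. -/
def HasModel (G : SimpleGraph V) (g : W → κ → Bool) : Prop :=
  ∃ (φ : W → V) (a b : κ → V), (∀ c, G.Adj (a c) (b c)) ∧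
    (∀ w c, φ w ∈ side G (a c) (b c) (g w c)) ∧
    ∀ x, (∀ u v, G.Adj u v → (∀ w, φ w ∈ halfspace G u v) → x ∈ halfspace G u v) →
      ∃ w, ∀ c, x ∈ side G (a c) (b c) (g w c)

variable [Fintype ι] [Fintype κ] {G : SimpleGraph V} {f : V → ι → Bool} {H : SimpleGraph W}
  {g : W → κ → Bool}

theorem IsCubeRep.mem_side (hG : IsCubeRep G f) {u v x : V} {i : ι} {b : Bool} (h : G.Adj u v)
    (hi : f u i ≠ f v i) : x ∈ side G u v b ↔ (f x i = f u i ↔ b = true) := by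
  cases b
  · rw [side, if_neg (by simp), hG.mem_halfspace h.symm hi.symm]
    revert hi
    cases f u i <;> cases f v i <;> cases f x i <;> simp
  · rw [side, if_pos rfl, hG.mem_halfspace h hi]
    simp

variable [DecidableEq ι]

/-- `H` has two coordinate systems, the given `g` and the `g'` inherited from `G`. They are matched
through halfspaces, which depend on the graph only: an edge of `H` flipping `c` in `g` flips some
`j` in `g'`, and an edge of `G` flipping `j` represents `c`. -/
theorem IsPCMinor.hasModel (hG : IsCubeRep G f) (hH : IsCubeRep H g) [Nonempty W]
    (hg : ∀ c, ∃ w w', g w c ≠ g w' c) (h : IsPCMinor G H) : HasModel G g := by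
  obtain ⟨g', I, s, K, hg', hr⟩ := h.exists_rep hG
  have hr' := fun a => Set.ext_iff.1 hr a
  have hφ : ∀ w, ∃ x, (∀ i ∈ I, f x i = s i) ∧ g' w = clear K (f x) := fun w => (hr' _).1 ⟨w, rfl⟩
  choose φ hφI hφ using hφ
  have hedge : ∀ c, ∃ a b, G.Adj a b ∧
      ∀ x w, g' w = clear K (f x) → x ∈ side G a b (g w c) := by
    intro c
    obtain ⟨p, q, hpq, hp, hq⟩ : ∃ p q, H.Adj p q ∧ g p c = true ∧ g q c = false := by
      obtain ⟨w, w', hw⟩ := hg c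
      cases h : g w c
      · obtain ⟨p, q, hpq, hp, hq⟩ := hH.exists_adj hw.symm
        refine ⟨p, q, hpq, ?_, hq.trans h⟩
        rw [hp]
        rw [h] at hw
        simpa using hw.symm
      · obtain ⟨p, q, hpq, hp, hq⟩ := hH.exists_adj hw
        refine ⟨p, q, hpq, hp.trans h, ?_⟩
        rw [hq]
        rw [h] at hw
        simpa using hw.symm
    obtain ⟨j, hj, -⟩ := hg'.adj_iff.1 hpq
    have hjK : j ∉ K := by
      intro hjK
      rw [hφ p, hφ q, clear_of_mem hjK, clear_of_mem hjK] at hj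
      exact hj rfl
    have hj' : f (φ p) j ≠ f (φ q) j := by
      rwa [hφ p, hφ q, clear_of_notMem hjK, clear_of_notMem hjK] at hj
    obtain ⟨a, b, hab, ha, hb⟩ := hG.exists_adj hj'
    refine ⟨a, b, hab, fun x w hw => ?_⟩
    rw [hG.mem_side hab (i := j) (by rwa [ha, hb]), ha, ← clear_of_notMem (a := f x) hjK, ← hw,
      ← clear_of_notMem (a := f (φ p)) hjK, ← hφ p, ← hg'.mem_halfspace hpq hj,
      hH.mem_halfspace hpq (i := c) (by simp [hp, hq]), hp]
  choose a b hab hside using hedge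
  refine ⟨φ, a, b, hab, fun w c => hside c _ _ (hφ w), fun x hx => ?_⟩
  -- If `x` violated a restriction, an edge flipping that coordinate would separate it from all `φ
  -- w`, hence from their hull.
  have hI : ∀ i ∈ I, f x i = s i := by
    intro i hi
    obtain ⟨w₀⟩ := ‹Nonempty W›
    by_contra hne
    rw [← hφI w₀ i hi] at hne
    obtain ⟨u, v, huv, hu, hv⟩ := hG.exists_adj (Ne.symm hne)
    have hi' : f u i ≠ f v i := by rw [hu, hv]; exact Ne.symm hne
    have := hx u v huv fun w => (hG.mem_halfspace huv hi').2 (by rw [hu, hφI w i hi, hφI w₀ i hi])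
    rw [hG.mem_halfspace huv hi', hu] at this
    exact hne this
  obtain ⟨w, hw⟩ := (hr' (clear K (f x))).2 ⟨x, hI, rfl⟩
  exact ⟨w, fun c => hside c x w hw⟩

/-- Restricting to the coordinates on which all `φ w` agree yields their hull. After contracting
every class except those of the chosen edges, the sign vectors that remain are exactly those of `H`.
-/
theorem HasModel.isPCMinor (hG : IsCubeRep G f) (hH : IsCubeRep H g) [Nonempty W]
    (hg : ∀ c, ∃ w w', g w c ≠ g w' c) (h : HasModel G g) : IsPCMinor G H := by
  classical
  obtain ⟨φ, a, b, hab, hφ, hhull⟩ := h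
  obtain ⟨w₀⟩ := ‹Nonempty W›
  have hj : ∀ c, ∃ j, f (a c) j ≠ f (b c) j := fun c => (hG.adj_iff.1 (hab c)).exists
  choose j hj using hj
  have hside : ∀ {c x e}, x ∈ side G (a c) (b c) e ↔ (f x (j c) = f (a c) (j c) ↔ e = true) :=
    fun {c x e} => hG.mem_side (hab c) (hj c)
  have hne : ∀ {x x' : V} {w w' : W}, (∀ c, x ∈ side G (a c) (b c) (g w c)) →
      (∀ c, x' ∈ side G (a c) (b c) (g w' c)) →
      ∀ c, f x (j c) ≠ f x' (j c) ↔ g w c ≠ g w' c := by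
    intro x x' w w' h h' c
    have h₁ := hside.1 (h c)
    have h₂ := hside.1 (h' c)
    revert h₁ h₂
    cases f x (j c) <;> cases f x' (j c) <;> cases f (a c) (j c) <;> cases g w c <;>
      cases g w' c <;> simp
  -- An edge of `H` flips a single coordinate `c`. If `c'` had the same class in `G`, the images of
  -- the ends would also be separated by the edge of `c'`.
  have hinj : Function.Injective j := by
    intro c c' hcc
    obtain ⟨w, w', hw⟩ := hg c
    obtain ⟨p, q, hpq, hp, hq⟩ := hH.exists_adj hw
    have h₁ : g p c ≠ g q c := by rwa [hp, hq]
    have h₂ := (hne (hφ p) (hφ q) c).2 h₁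
    rw [hcc, hne (hφ p) (hφ q)] at h₂
    exact (hH.adj_iff.1 hpq).unique h₁ h₂
  let I : Finset ι := Finset.univ.filter fun i => ∀ w, f (φ w) i = f (φ w₀) i
  let K : Finset ι := Finset.univ.filter fun i => ∀ c, i ≠ j c
  have hI : ∀ {i}, i ∈ I ↔ ∀ w, f (φ w) i = f (φ w₀) i := by simp [I]
  have hK : ∀ {i}, i ∈ K ↔ ∀ c, i ≠ j c := by simp [K]
  have hjK : ∀ c, j c ∉ K := fun c h => hK.1 h c rfl
  obtain ⟨W', H', g', hm, hg', hr⟩ := hG.exists_isPCMinor I (f (φ w₀)) K ⟨φ w₀, fun _ _ => rfl⟩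
  have hr' := fun a => Set.ext_iff.1 hr a
  have hρ : ∀ w', ∃ w x, g' w' = clear K (f x) ∧ ∀ c, x ∈ side G (a c) (b c) (g w c) := by
    intro w'
    obtain ⟨x, hx, hw'⟩ := (hr' _).1 ⟨w', rfl⟩
    obtain ⟨w, hw⟩ := hhull x fun u v huv hφu => by
      obtain ⟨i, hi, -⟩ := hG.adj_iff.1 huv
      simp only [hG.mem_halfspace huv hi] at hφu ⊢
      rw [hx i (hI.2 fun w => (hφu w).trans (hφu w₀).symm), hφu w₀]
    exact ⟨w, x, hw', hw⟩
  choose ρ x hx hρ using hρ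
  have hdiff : ∀ w w' c, g' w (j c) ≠ g' w' (j c) ↔ g (ρ w) c ≠ g (ρ w') c := by
    intro w w' c
    rw [hx w, hx w', clear_of_notMem (hjK c), clear_of_notMem (hjK c)]
    exact hne (hρ w) (hρ w') c
  have hout : ∀ w w' i, g' w i ≠ g' w' i → ∃ c, i = j c := by
    intro w w' i hi
    by_contra! h
    rw [hx w, hx w', clear_of_mem (hK.2 h), clear_of_mem (hK.2 h)] at hi
    exact hi rfl
  have hbij : Function.Bijective ρ := by
    constructor
    · intro w w' hww
      refine hg'.injective (funext fun i => ?_)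
      by_contra hi
      obtain ⟨c, rfl⟩ := hout w w' i hi
      exact (hdiff w w' c).1 hi (by rw [hww])
    · intro w
      obtain ⟨w', hw'⟩ := (hr' (clear K (f (φ w)))).2 ⟨φ w, fun i hi => hI.1 hi w, rfl⟩
      refine ⟨w', hH.injective (funext fun c => ?_)⟩
      by_contra hc
      refine (hne (hρ w') (hφ w) c).2 hc ?_
      rw [← clear_of_notMem (a := f (x w')) (hjK c), ← hx w', hw', clear_of_notMem (hjK c)]
  refine hm.iso ⟨Equiv.ofBijective ρ hbij, fun {w w'} => ?_⟩
  rw [Equiv.ofBijective_apply, Equiv.ofBijective_apply, hH.adj_iff, hg'.adj_iff]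
  constructor
  · rintro ⟨c, hc, huniq⟩
    refine ⟨j c, (hdiff w w' c).2 hc, fun i hi => ?_⟩
    obtain ⟨c', rfl⟩ := hout w w' i hi
    rw [huniq c' ((hdiff w w' c').1 hi)]
  · rintro ⟨i, hi, huniq⟩
    obtain ⟨c, rfl⟩ := hout w w' i hi
    exact ⟨c, (hdiff w w' c).1 hi, fun c' hc' => hinj (huniq _ ((hdiff w w' c').2 hc'))⟩

end Model

/-! ### Coordinates from the definition of a partial cube. -/

section Existence

theorem isCubeRep_hypercube (d : ℕ) : IsCubeRep (hypercube d) id where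
  injective := Function.injective_id
  adj_iff := Iff.rfl
  exists_agree {x y} hxy := by
    obtain ⟨i, hi⟩ := Function.ne_iff.1 hxy
    exact ⟨Function.update x i (y i), i, hi, by simp, fun j hj => by simp [hj]⟩

/-- The first edge of a geodesic from `x` to `y` flips a coordinate where they differ, for otherwise
it would lead away from `y`. -/
theorem isCubeRep_of_edist_eq {G : SimpleGraph V} {d : ℕ} (f : G ↪g hypercube d)
    (hf : ∀ u v, G.edist u v = (hypercube d).edist (f u) (f v)) : IsCubeRep G f where
  injective := f.injective
  adj_iff {x y} := f.map_adj_iff.symm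
  exists_agree {x y} hxy := by
    have hdist : ∀ u v, G.edist u v = hammingDist (f u) (f v) := fun u v =>
      (hf u v).trans ((isCubeRep_hypercube d).edist_eq _ _)
    obtain ⟨p, hp⟩ := SimpleGraph.exists_walk_of_edist_eq_coe (hdist x y)
    cases p with
    | nil => exact absurd rfl hxy
    | @cons _ z _ hadj p =>
      obtain ⟨i, hi, huniq⟩ := f.map_adj_iff.2 hadj
      have hz : ∀ j, j ≠ i → f z j = f x j := fun j hj => by
        by_contra h
        exact hj (huniq j (Ne.symm h))
      have hle := p.edist_le
      rw [hdist, Nat.cast_le] at hle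
      rw [SimpleGraph.Walk.length_cons] at hp
      have hxi : f x i ≠ f y i := by
        intro hxi
        have := hammingDist_lt (a := f z) (b := f y) (c := f x) (i := i)
          (by rw [← hxi]; exact Ne.symm hi) hxi fun j hj => (hz j hj).symm
        omega
      refine ⟨z, i, hxi, ?_, hz⟩
      revert hi hxi
      cases f x i <;> cases f y i <;> cases f z i <;> simp

theorem IsPartialCube.exists_isCubeRep {G : SimpleGraph V} (h : IsPartialCube G) :
    ∃ (d : ℕ) (f : V → Fin d → Bool), IsCubeRep G f :=
  let ⟨_, d, f, hf⟩ := h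
  ⟨d, f, isCubeRep_of_edist_eq f hf⟩

/-- Constant coordinates are dropped, since no edge flips them while a model assigns an edge to
every coordinate. -/
theorem IsPartialCube.exists_isCubeRep_nonconstant {G : SimpleGraph V} (h : IsPartialCube G) :
    ∃ (d : ℕ) (f : V → Fin d → Bool), IsCubeRep G f ∧ ∀ c, ∃ x y, f x c ≠ f y c := by
  classical
  obtain ⟨d, f, hf⟩ := h.exists_isCubeRep
  let C := {c : Fin d // ∃ x y, f x c ≠ f y c}
  let e : C ≃ Fin (Fintype.card C) := Fintype.equivFin C
  refine ⟨_, fun x c => f x (e.symm c), ⟨fun x y hxy => ?_, fun {x y} => ?_, fun {x y} hxy => ?_⟩,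
    fun c => (e.symm c).2⟩
  · refine hf.injective (funext fun c => ?_)
    by_contra hc
    have := congrFun hxy (e ⟨c, x, y, hc⟩)
    simp only [Equiv.symm_apply_apply] at this
    exact hc this
  · rw [hf.adj_iff]
    constructor
    · rintro ⟨c, hc, huniq⟩
      refine ⟨e ⟨c, x, y, hc⟩, by simpa using hc, fun c' hc' => ?_⟩
      rw [← Equiv.symm_apply_eq]
      exact Subtype.ext (huniq _ hc')
    · rintro ⟨c, hc, huniq⟩
      refine ⟨(e.symm c).1, hc, fun c' hc' => ?_⟩
      have := huniq (e ⟨c', x, y, hc'⟩) (by simpa using hc')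
      rw [← this, Equiv.symm_apply_apply]
  · obtain ⟨z, c, h₁, h₂, h₃⟩ := hf.exists_agree hxy
    refine ⟨z, e ⟨c, x, y, h₁⟩, by simpa using h₁, by simpa using h₂, fun c' hc' => h₃ _ ?_⟩
    rintro hcc
    apply hc'
    rw [← Equiv.symm_apply_eq]
    exact Subtype.ext hcc

end Existence

end CubeRep

end PartialCubes

/-! ### The existence of a model as an expression. -/

namespace PartialCubes

section Formula

open VecExpr

variable {n : ℕ} {G : SimpleGraph (Fin n)}

open Classical in
/-- The adjacency matrix of a graph. -/
noncomputable def matrix (G : SimpleGraph (Fin n)) (i j : Fin n) : Bool := decide (G.Adj i j)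

/-- The expression for the adjacency of two vertices. -/
def adjExpr (e e' : VecExpr) : VecExpr := .any (.op and e (.mul e'))

/-- The expression for the membership of a vertex in a set. -/
def memExpr (e e' : VecExpr) : VecExpr := .any (.op and e e')

/-- The expression for one of the two halfspaces of an edge. -/
def sideExpr (e e' : VecExpr) (b : Bool) : VecExpr := if b then .half e e' else .half e' e

variable {d : ℕ} {ρ : ℕ → Fin n → Bool} {e e' : VecExpr} {u v i x : Fin n}

theorem prod_matrix {y : Fin n → Bool} :
    prod (matrix G) y x = true ↔ ∃ z, G.Adj x z ∧ y z = true := by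
  simp [prod, matrix]

theorem eval_adjExpr (he : eval (matrix G) d ρ e = fun j => decide (j = u))
    (he' : eval (matrix G) d ρ e' = fun j => decide (j = v)) :
    eval (matrix G) d ρ (adjExpr e e') i = true ↔ G.Adj u v := by
  simp only [adjExpr, eval_any, eval_and, he, eval_mul, he', Bool.and_eq_true, prod_matrix,
    decide_eq_true_eq]
  simp

theorem eval_memExpr (he : eval (matrix G) d ρ e = fun j => decide (j = u)) :
    eval (matrix G) d ρ (memExpr e e') i = true ↔ eval (matrix G) d ρ e' u = true := by
  simp [memExpr, he]

theorem ball_eq_true_iff {k : ℕ} :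
    ball (matrix G) (fun j => decide (j = u)) k x = true ↔ G.edist x u ≤ k := by
  induction k generalizing x with
  | zero => simp [ball]
  | succ k ih =>
    simp only [ball, Bool.or_eq_true, ih, prod_matrix]
    constructor
    · rintro (h | ⟨z, hz, h⟩)
      · exact h.trans (by norm_cast; omega)
      · calc G.edist x u ≤ G.edist x z + G.edist z u := SimpleGraph.edist_triangle
          _ ≤ 1 + k := add_le_add (SimpleGraph.edist_eq_one_iff_adj.2 hz).le h
          _ = (k + 1 : ℕ) := by push_cast; ring
    · intro h
      obtain ⟨p, hp⟩ := SimpleGraph.exists_walk_of_edist_ne_top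
        (ne_top_of_le_ne_top (ENat.natCast_ne_top _) h)
      rw [← hp, Nat.cast_le] at h
      cases p with
      | nil => exact .inl (by simp)
      | @cons _ z _ hadj p =>
        refine .inr ⟨z, hadj, p.edist_le.trans ?_⟩
        rw [SimpleGraph.Walk.length_cons] at h
        exact_mod_cast (by omega : p.length ≤ k)

theorem eval_half (he : eval (matrix G) d ρ e = fun j => decide (j = u))
    (he' : eval (matrix G) d ρ e' = fun j => decide (j = v)) :
    eval (matrix G) d ρ (.half e e') x = true ↔ x ∈ halfspace G u v := by
  simp only [eval, he, he', List.any_eq_true, List.mem_range, Bool.and_eq_true,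
    Bool.not_eq_true', ← Bool.not_eq_true, ball_eq_true_iff, not_le, halfspace,
    Set.mem_ofPred_eq]
  constructor
  · rintro ⟨k, -, h₁, h₂⟩
    exact h₁.trans_lt h₂
  · intro h
    have hr := SimpleGraph.reachable_of_edist_ne_top h.ne_top
    obtain ⟨p, hp, hlen⟩ := hr.exists_path_of_dist
    -- The radius `G.dist x u` separates the balls. It is below `n` because a shortest path repeats
    -- no vertex, so the `n` radii tested suffice.
    refine ⟨G.dist x u, ?_, hr.coe_dist_eq_edist.ge, hr.coe_dist_eq_edist.trans_lt h⟩
    rw [← hlen]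
    simpa using hp.length_lt

theorem eval_sideExpr {b : Bool} (he : eval (matrix G) d ρ e = fun j => decide (j = u))
    (he' : eval (matrix G) d ρ e' = fun j => decide (j = v)) :
    eval (matrix G) d ρ (sideExpr e e' b) x = true ↔ x ∈ side G u v b := by
  cases b
  · exact eval_half he' he
  · exact eval_half he he'

variable {m k : ℕ}

/-- The expression for the convex hull of the vertices given by the first `m` of the `d` bound
variables. -/
def hullExpr (m d : ℕ) : VecExpr :=
  neg (.ex (.ex (.op and (adjExpr (.var d) (.var (d + 1))) (.op and
    (conj ((List.finRange m).map fun w : Fin m => memExpr (.var w) (.half (.var d) (.var (d + 1)))))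
    (neg (.half (.var d) (.var (d + 1))))))))

theorem eval_hullExpr (hm : m ≤ d) {w : ℕ → Fin n} (hρ : ∀ j < m, ρ j = fun x => decide (x = w j)) :
    eval (matrix G) d ρ (hullExpr m d) x = true ↔ ∀ u v, G.Adj u v →
      (∀ j : Fin m, w j ∈ halfspace G u v) → x ∈ halfspace G u v := by
  simp only [hullExpr, eval_neg, Bool.not_eq_true', ← Bool.not_eq_true, eval_ex, eval_and,
    Bool.and_eq_true, not_exists, eval_conj, List.mem_map, List.mem_finRange, true_and,
    forall_exists_index, forall_apply_eq_imp_iff]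
  refine forall_congr' fun u => forall_congr' fun v => ?_
  set ρ' := Function.update (Function.update ρ d fun j => decide (j = u)) (d + 1)
    fun j => decide (j = v)
  have hu : eval (matrix G) (d + 1 + 1) ρ' (.var d) = fun j => decide (j = u) := by
    simp [ρ']
  have hv : eval (matrix G) (d + 1 + 1) ρ' (.var (d + 1)) = fun j => decide (j = v) := by
    simp [ρ']
  have hw : ∀ j : Fin m, eval (matrix G) (d + 1 + 1) ρ' (.var j) = fun x => decide (x = w j) := by
    intro j
    have := j.2
    simp only [ρ']
    rw [eval_var, Function.update_of_ne (by omega), Function.update_of_ne (by omega),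
      hρ j j.2]
  rw [eval_adjExpr hu hv, eval_half hu hv]
  simp only [eval_memExpr (hw _), eval_half hu hv]
  tauto

/-- The expression for the existence of a model with the given coordinates. -/
def modelExpr (g : Fin m → Fin k → Bool) : VecExpr :=
  let a (c : Fin k) : VecExpr := .var (m + 2 * c)
  let b (c : Fin k) : VecExpr := .var (m + 2 * c + 1)
  exs (m + 2 * k) (conj
    [conj ((List.finRange k).map fun c : Fin k => adjExpr (a c) (b c)),
      conj ((List.finRange m).map fun w : Fin m => conj ((List.finRange k).map fun c : Fin k =>
        memExpr (.var w) (sideExpr (a c) (b c) (g w c)))),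
      neg (.any (.op and (hullExpr m (m + 2 * k)) (neg (disj ((List.finRange m).map fun w : Fin m =>
        conj ((List.finRange k).map fun c : Fin k => sideExpr (a c) (b c) (g w c)))))))])

theorem eval_modelExpr (g : Fin m → Fin k → Bool) :
    eval (matrix G) 0 ρ (modelExpr g) i = true ↔ HasModel G g := by
  have key : ∀ w : ℕ → Fin n, eval (matrix G) (0 + (m + 2 * k))
      (fun j => if 0 ≤ j ∧ j < 0 + (m + 2 * k) then fun x => decide (x = w j) else ρ j) (conj
    [conj ((List.finRange k).map fun c : Fin k =>
        adjExpr (.var (m + 2 * c)) (.var (m + 2 * c + 1))),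
      conj ((List.finRange m).map fun w : Fin m => conj ((List.finRange k).map fun c : Fin k =>
        memExpr (.var w) (sideExpr (.var (m + 2 * c)) (.var (m + 2 * c + 1)) (g w c)))),
      neg (.any (.op and (hullExpr m (m + 2 * k)) (neg (disj ((List.finRange m).map fun w : Fin m =>
        conj ((List.finRange k).map fun c : Fin k =>
          sideExpr (.var (m + 2 * c)) (.var (m + 2 * c + 1)) (g w c)))))))]) i = true ↔
      (∀ c : Fin k, G.Adj (w (m + 2 * c)) (w (m + 2 * c + 1))) ∧
      (∀ (j : Fin m) (c : Fin k), w j ∈ side G (w (m + 2 * c)) (w (m + 2 * c + 1)) (g j c)) ∧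
      ∀ x, (∀ u v, G.Adj u v → (∀ j : Fin m, w j ∈ halfspace G u v) → x ∈ halfspace G u v) →
        ∃ j, ∀ c : Fin k, x ∈ side G (w (m + 2 * c)) (w (m + 2 * c + 1)) (g j c) := by
    intro w
    simp only [Nat.zero_add, Nat.zero_le, true_and]
    set ρ' : ℕ → Fin n → Bool :=
      fun j => if j < m + 2 * k then fun x => decide (x = w j) else ρ j
    have hvar : ∀ j < m + 2 * k,
        eval (matrix G) (m + 2 * k) ρ' (.var j) = fun x => decide (x = w j) :=
      fun j hj => if_pos hj
    have ha : ∀ c : Fin k, eval (matrix G) (m + 2 * k) ρ' (.var (m + 2 * c)) =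
        fun x => decide (x = w (m + 2 * c)) := fun c => hvar _ (by omega)
    have hb : ∀ c : Fin k, eval (matrix G) (m + 2 * k) ρ' (.var (m + 2 * c + 1)) =
        fun x => decide (x = w (m + 2 * c + 1)) := fun c => hvar _ (by omega)
    have hφ : ∀ j : Fin m, eval (matrix G) (m + 2 * k) ρ' (.var j) =
        fun x => decide (x = w j) := fun j => hvar _ (by omega)
    simp only [eval_conj, List.mem_cons, List.not_mem_nil, or_false, forall_eq_or_imp, forall_eq,
      List.mem_map, List.mem_finRange, true_and, forall_exists_index, forall_apply_eq_imp_iff,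
      eval_adjExpr (ha _) (hb _), eval_memExpr (hφ _), eval_sideExpr (ha _) (hb _), eval_neg,
      Bool.not_eq_true', ← Bool.not_eq_true, eval_any, eval_and, Bool.and_eq_true, not_exists,
      eval_disj, exists_exists_eq_and, not_and]
    refine and_congr_right' (and_congr_right' (forall_congr' fun x => ?_))
    rw [eval_hullExpr (ρ := ρ') (Nat.le_add_right m (2 * k)) fun j hj => hvar j (by omega)]
    rw [not_forall]
    simp only [not_not]
  rw [modelExpr, eval_exs]
  simp only [key]
  constructor
  · rintro ⟨w, h₁, h₂, h₃⟩
    exact ⟨fun j => w j, fun c => w (m + 2 * c), fun c => w (m + 2 * c + 1), h₁, h₂, h₃⟩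
  · rintro ⟨φ, a, b, h⟩
    -- The first `m` variables hold `φ`, followed by the ends of the edges in alternation; beyond
    -- these, `i` is a dummy value.
    let w : ℕ → Fin n := fun j => if h : j < m then φ ⟨j, h⟩ else
      if h : (j - m) / 2 < k then (if (j - m) % 2 = 0 then a ⟨(j - m) / 2, h⟩
        else b ⟨(j - m) / 2, h⟩) else i
    have hφ : ∀ j : Fin m, w j = φ j := fun j => dif_pos j.2
    have ha : ∀ c : Fin k, w (m + 2 * c) = a c := by
      intro c
      simp [w]
    have hb : ∀ c : Fin k, w (m + 2 * c + 1) = b c := by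
      intro c
      have h₁ : (m + 2 * (c : ℕ) + 1 - m) / 2 = c := by omega
      have h₂ : (m + 2 * (c : ℕ) + 1 - m) % 2 = 1 := by omega
      simp only [w]
      rw [dif_neg (by omega), dif_pos (by omega), if_neg (by omega)]
      exact congrArg b (Fin.ext h₁)
    refine ⟨w, ?_⟩
    simpa only [hφ, ha, hb] using h

end Formula

end PartialCubes

/-! ### The proposition. -/

theorem proposition2p5 (X : Set PartialCubes.PartialCube) (hX : X.Finite) :
    PartialCubes.DecidableInPolyTime PartialCubes.PartialCube.encode
      (fun G => G ∈ PartialCubes.excluding X) := by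
  have hrep := fun H : PartialCubes.PartialCube => H.isPartialCube.exists_isCubeRep_nonconstant
  choose k g hg hg' using hrep
  refine VecExpr.decidableInPolyTime (n := PartialCubes.PartialCube.n)
    (M := fun G => PartialCubes.matrix G.graph)
    (.neg (.disj (hX.toFinset.toList.map fun H => PartialCubes.modelExpr (g H))))
    (fun _ => rfl) fun G => ?_
  obtain ⟨d, f, hf⟩ := G.isPartialCube.exists_isCubeRep
  have hminor : ∀ H : PartialCubes.PartialCube, PartialCubes.HasModel G.graph (g H) ↔
      PartialCubes.IsPCMinor G.graph H.graph := fun H =>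
    have := H.isPartialCube.1
    ⟨fun h => h.isPCMinor hf (hg H) (hg' H), fun h => h.hasModel hf (hg H) (hg' H)⟩
  -- The expression evaluates to a constant vector, and since `G` has a vertex, some entry is true
  -- exactly if the common truth value is true.
  have := G.isPartialCube.1
  simp only [VecExpr.eval_neg, Bool.not_eq_true', ← Bool.not_eq_true, VecExpr.eval_disj,
    List.mem_map, Finset.mem_toList, Set.Finite.mem_toFinset, exists_exists_and_eq_and,
    PartialCubes.eval_modelExpr, hminor, exists_const]
  simp [PartialCubes.excluding]
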